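/- Let $x_1,\dots,x_m\in\mathbb R^2$ be distinct points, put $X=\{x_1,\dots,x_m\}$, and let $H$ be the minimal Schrödinger operator in $L^2(\mathbb R^2)$, $H=-\Delta$ with $\operatorname{dom}H=\{f\in W^{2,2}(\mathbb R^2): f(x_j)=0,\ j=1,\dots,m\}$. Then $H$ is densely defined, closed and symmetric. Every $f\in\operatorname{dom}H^*$ has a representative that is continuous on $\mathbb R^2\setminus X$, for which the limits $$\xi_j(f)=\lim_{x\to x_j}\frac{f(x)}{\ln|x-x_j|},\qquad \lim_{x\to x_j}\bigl(f(x)-\xi_j(f)\ln|x-x_j|\bigr)$$ exist for all $j$, and $\Pi=\{\mathbb C^m,\Gamma_0,\Gamma_1\}$ with $$\Gamma_0f=-2\pi\,\{\xi_j(f)\}_{j=1}^m,\qquad \Gamma_1f=\Bigl\{\lim_{x\to x_j}\bigl(f(x)-\xi_j(f)\ln|x-x_j|\bigr)\Bigr\}_{j=1}^m,\qquad f\in\operatorname{dom}H^*,$$ is a boundary triplet for $H^*$: $\Gamma_0,\Gamma_1$ are linear, $(H^*f,g)-(f,H^*g)=(\Gamma_1f,\Gamma_0g)-(\Gamma_0f,\Gamma_1g)$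 for all $f,g\in\operatorname{dom}H^*$, and $(\Gamma_0,\Gamma_1)$ maps $\operatorname{dom}H^*$ onto $\mathbb C^m\oplus\mathbb C^m$. Put $H_0=H^*\upharpoonright\ker\Gamma_0$ and $\mathfrak N_z=\ker(H^*-z)$. For $z\in\rho(H_0)$ the map $\Gamma_0\upharpoonright\mathfrak N_z$ is a bijection onto $\mathbb C^m$; the $\gamma$-field is $\gamma(z)=(\Gamma_0\upharpoonright\mathfrak N_z)^{-1}$, and the Weyl function $M(z)$ is the operator in $\mathbb C^m$ with $M(z)\Gamma_0f=\Gamma_1f$ for all $f\in\mathfrak N_z$. Let $\sqrt z$ be the branch with $\operatorname{Im}\sqrt z>0$ on $\mathbb C\setminus[0,\infty)$, let $\ln$ be the principal logarithm, let $H_0^{(1)}$ be the Hankel function of the first kind and order zero, and let $\psi(1)=\Gamma'(1)/\Gamma(1)$, where $\Gamma$ here is Euler's gamma function. Then for every $z\in\mathbb C\setminus[0,\infty)$ (in particular for every $z$ in the open upper half-plane) one has $z\in\rho(H_0)$ and (i) $$M(z)=\Bigl(\tfrac1{2\pi}\bigl(\psi(1)-\ln\tfrac{\sqrt z}{2i}\bigr)\delta_{jk}+\widetilde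 G_{\sqrt z}(x_j-x_k)\Bigr)_{j,k=1}^m,\qquad \widetilde G_{\sqrt z}(x)=\begin{cases}\tfrac i4H_0^{(1)}(\sqrt z\,|x|),&x\ne0,\\0,&x=0;\end{cases}$$ (ii) $$\gamma(z)\{a_j\}_{j=1}^m=\sum_{j=1}^m a_j\,\tfrac i4H_0^{(1)}(\sqrt z\,|x-x_j|),\qquad \{a_j\}_{j=1}^m\in\mathbb C^m .$$ -/

import Mathlib

open MeasureTheory Filter Topology
open scoped LinearPMap SchwartzMap LineDeriv Laplacian TemperedDistribution

noncomputable section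

/-! ## Boundary triplets, gamma-fields and Weyl functions of symmetric operators -/

namespace BoundaryTriplets

section Abstract

variable {E K : Type*} [NormedAddCommGroup E] [InnerProductSpace ℂ E] [CompleteSpace E]
  [NormedAddCommGroup K] [InnerProductSpace ℂ K] [CompleteSpace K]

/-- The resolvent set of an unbounded operator `A`: the complex numbers `z` for which `A - z` maps
`dom A` bijectively onto the whole space and has a bounded inverse `R`. -/
def resolventSet (A : E →ₗ.[ℂ] E) : Set ℂ :=
  {z | ∃ R : E →L[ℂ] E, (∀ f : A.domain, R (A f - z • (f : E)) = f) ∧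
    ∀ g : E, ∃ h : R g ∈ A.domain, A ⟨R g, h⟩ - z • R g = g}

/-- The defect subspace `𝔑_z = ker (A* - z)`, as a subspace of `dom A*`. -/
def defectSubspace (A : E →ₗ.[ℂ] E) (z : ℂ) : Submodule ℂ A†.domain :=
  LinearMap.ker (A†.toFun - z • A†.domain.subtype)

theorem mem_defectSubspace {A : E →ₗ.[ℂ] E} {z : ℂ} {f : A†.domain} :
    f ∈ defectSubspace A z ↔ A† f = z • (f : E) := by
  simp [defectSubspace, LinearMap.mem_ker, sub_eq_zero]

/-- A boundary triplet `{K, Γ₀, Γ₁}` for the adjoint `A*` of a densely defined closed symmetric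
operator `A`. Mathlib's `inner ℂ` is linear in its second argument, so that the product
`(u, v)`, linear in `u`, is `inner ℂ v u`. -/
structure BoundaryTriplet (A : E →ₗ.[ℂ] E) (K : Type*) [NormedAddCommGroup K]
    [InnerProductSpace ℂ K] [CompleteSpace K] where
  dense_domain : Dense (A.domain : Set E)
  symmetric : A.IsFormalAdjoint A
  closed : A.IsClosed
  Γ₀ : A†.domain →ₗ[ℂ] K
  Γ₁ : A†.domain →ₗ[ℂ] K
  /-- The abstract second Green identity
  `(A* f, g) - (f, A* g) = (Γ₁ f, Γ₀ g) - (Γ₀ f, Γ₁ g)`. -/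
  green : ∀ f g : A†.domain,
    inner ℂ (g : E) (A† f) - inner ℂ (A† g) (f : E) =
      inner ℂ (Γ₀ g) (Γ₁ f) - inner ℂ (Γ₁ g) (Γ₀ f)
  /-- `(Γ₀, Γ₁)` maps `dom A*` onto `K ⊕ K`. -/
  surjective : ∀ h₀ h₁ : K, ∃ f : A†.domain, Γ₀ f = h₀ ∧ Γ₁ f = h₁

namespace BoundaryTriplet

variable {A : E →ₗ.[ℂ] E} (T : BoundaryTriplet A K)

/-- The extension `A₀ = A* ↾ ker Γ₀`. -/
def A₀ : E →ₗ.[ℂ] E :=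
  A†.domRestrict ((LinearMap.ker T.Γ₀).map A†.domain.subtype)

theorem mem_A₀_domain {f : E} :
    f ∈ T.A₀.domain ↔ ∃ h : f ∈ A†.domain, T.Γ₀ ⟨f, h⟩ = 0 := by
  simp only [A₀, LinearPMap.domRestrict_domain, Submodule.mem_inf, Submodule.mem_map,
    LinearMap.mem_ker, Submodule.subtype_apply]
  constructor
  · rintro ⟨⟨g, hg, rfl⟩, h⟩
    exact ⟨h, hg⟩
  · rintro ⟨h, h0⟩
    exact ⟨⟨⟨f, h⟩, h0, rfl⟩, h⟩

theorem A₀_apply (f : T.A₀.domain) (h : (f : E) ∈ A†.domain) :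
    T.A₀ f = A† ⟨f, h⟩ :=
  LinearPMap.domRestrict_apply (f := A†) (x := f) rfl

/-- For `z ∈ ρ(A₀)` the map `Γ₀` is a bijection from `𝔑_z` onto `K`. -/
theorem bijective_restrict {z : ℂ} (hz : z ∈ resolventSet T.A₀) :
    Function.Bijective (T.Γ₀.domRestrict (defectSubspace A z)) := by
  obtain ⟨R, hR₁, hR₂⟩ := hz
  constructor
  · rw [injective_iff_map_eq_zero]
    rintro ⟨f, hf⟩ h0
    have h0' : T.Γ₀ f = 0 := h0
    have hm : (f : E) ∈ T.A₀.domain := T.mem_A₀_domain.2 ⟨f.2, h0'⟩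
    have h1 := hR₁ ⟨f, hm⟩
    rw [T.A₀_apply ⟨f, hm⟩ f.2, mem_defectSubspace.1 hf, sub_self, map_zero] at h1
    ext
    exact h1.symm
  · intro k
    obtain ⟨f, hf, -⟩ := T.surjective k 0
    obtain ⟨h, hg⟩ := hR₂ (A† f - z • (f : E))
    obtain ⟨h', hΓ⟩ := T.mem_A₀_domain.1 h
    rw [T.A₀_apply _ h'] at hg
    set g : A†.domain := ⟨_, h'⟩ with hgdef
    refine ⟨⟨f - g, mem_defectSubspace.2 ?_⟩, ?_⟩
    · have hg' : A† g - z • (g : E) = A† f - z • (f : E) := hg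
      rw [LinearPMap.map_sub, Submodule.coe_sub, smul_sub, sub_eq_sub_iff_sub_eq_sub]
      exact hg'.symm
    · change T.Γ₀ (f - g) = k
      rw [map_sub, hf, hΓ, sub_zero]

/-- The gamma-field `γ(z) = (Γ₀ ↾ 𝔑_z)⁻¹ : K → 𝔑_z`, for `z ∈ ρ(A₀)`. -/
def gammaField (z : ℂ) (hz : z ∈ resolventSet T.A₀) : K →ₗ[ℂ] defectSubspace A z :=
  (LinearEquiv.ofBijective (T.Γ₀.domRestrict (defectSubspace A z))
    (T.bijective_restrict hz)).symm.toLinearMap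

/-- The Weyl function `M(z) : K → K`, for `z ∈ ρ(A₀)`: the operator with
`M(z) Γ₀ f = Γ₁ f` for all `f ∈ 𝔑_z` (see `weylFunction_unique`). -/
def weylFunction (z : ℂ) (hz : z ∈ resolventSet T.A₀) : K →ₗ[ℂ] K :=
  T.Γ₁ ∘ₗ (defectSubspace A z).subtype ∘ₗ T.gammaField z hz

theorem weylFunction_unique {z : ℂ} (hz : z ∈ resolventSet T.A₀) (M : K →ₗ[ℂ] K) :
    (∀ f ∈ defectSubspace A z, M (T.Γ₀ f) = T.Γ₁ f) ↔ M = T.weylFunction z hz := by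
  set e := LinearEquiv.ofBijective (T.Γ₀.domRestrict (defectSubspace A z))
    (T.bijective_restrict hz) with he
  have key : ∀ k, T.weylFunction z hz k = T.Γ₁ (e.symm k : A†.domain) := fun _ => rfl
  have hΓ : ∀ f : defectSubspace A z, e f = T.Γ₀ f := fun _ => rfl
  constructor
  · intro h
    ext k
    rw [key, ← h _ (e.symm k).2, ← hΓ, e.apply_symm_apply]
  · rintro rfl f hf
    rw [key, ← hΓ ⟨f, hf⟩, e.symm_apply_apply]

end BoundaryTriplet

end Abstract

end BoundaryTriplets

/-! ## The minimal Schrödinger operator with point interactions on the plane -/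

namespace PointInteraction

open BoundaryTriplets

/-- The Euclidean plane `ℝ²`. -/
abbrev Plane : Type := EuclideanSpace ℝ (Fin 2)

/-- The Hilbert space `L²(ℝ²)`. -/
abbrev L2 : Type := Lp ℂ 2 (volume : Measure Plane)

/-- The standard basis vectors of the plane. -/
abbrev stdVec (i : Fin 2) : Plane := EuclideanSpace.basisFun (Fin 2) ℝ i

/-- `f ∈ L²(ℝ²)` seen as a tempered distribution. -/
def toDist : L2 →L[ℂ] 𝓢'(Plane, ℂ) := Lp.toTemperedDistributionCLM ℂ (volume : Measure Plane) 2

theorem toDist_injective : Function.Injective toDist :=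
  LinearMap.ker_eq_bot.1 (Lp.ker_toTemperedDistributionCLM_eq_bot (F := ℂ) (p := 2)
    (μ := (volume : Measure Plane)))

/-- The Sobolev space `W^{2,2}(ℝ²)`: the functions in `L²` all of whose distributional
derivatives of order one and two are in `L²`. -/
def W22 : Submodule ℂ L2 where
  carrier := {f | (∀ i, ∃ g : L2, toDist g = ∂_{stdVec i} (toDist f)) ∧
    ∀ i j, ∃ g : L2, toDist g = ∂_{stdVec i} (∂_{stdVec j} (toDist f))}
  zero_mem' := by
    refine ⟨fun i => ⟨0, ?_⟩, fun i j => ⟨0, ?_⟩⟩ <;>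
      simp only [map_zero, LineDeriv.lineDerivOp_zero]
  add_mem' := by
    rintro f f' ⟨h1, h2⟩ ⟨h1', h2'⟩
    refine ⟨fun i => ?_, fun i j => ?_⟩
    · obtain ⟨g, hg⟩ := h1 i
      obtain ⟨g', hg'⟩ := h1' i
      exact ⟨g + g', by simp only [map_add, LineDeriv.lineDerivOp_add] at *; rw [hg, hg']⟩
    · obtain ⟨g, hg⟩ := h2 i j
      obtain ⟨g', hg'⟩ := h2' i j
      exact ⟨g + g', by simp only [map_add, LineDeriv.lineDerivOp_add] at *; rw [hg, hg']⟩
  smul_mem' := by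
    rintro c f ⟨h1, h2⟩
    refine ⟨fun i => ?_, fun i j => ?_⟩
    · obtain ⟨g, hg⟩ := h1 i
      exact ⟨c • g, by simp only [map_smul, LineDeriv.lineDerivOp_smul] at *; rw [hg]⟩
    · obtain ⟨g, hg⟩ := h2 i j
      exact ⟨c • g, by simp only [map_smul, LineDeriv.lineDerivOp_smul] at *; rw [hg]⟩

theorem exists_neg_laplacian {f : L2} (hf : f ∈ W22) : ∃ g : L2, toDist g = -Δ (toDist f) := by
  choose g hg using fun i => hf.2 i i
  refine ⟨-∑ i, g i, ?_⟩
  rw [TemperedDistribution.laplacian_eq_sum (EuclideanSpace.basisFun (Fin 2) ℝ)]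
  simp only [map_neg, map_sum] at *
  simp only [hg]

/-- The functions of `W^{2,2}(ℝ²)` that vanish at the points `x_j`. Values at points are those of
the continuous representative. -/
def minimalDomain {m : ℕ} (x : Fin m → Plane) : Submodule ℂ L2 where
  carrier := {f | f ∈ W22 ∧ ∃ u : Plane → ℂ, Continuous u ∧ f =ᵐ[volume] u ∧ ∀ j, u (x j) = 0}
  zero_mem' := ⟨zero_mem _, 0, continuous_zero, Lp.coeFn_zero _ _ _, fun _ => rfl⟩
  add_mem' := by
    rintro f g ⟨hf, u, hu, hfu, hu0⟩ ⟨hg, v, hv, hgv, hv0⟩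
    exact ⟨add_mem hf hg, u + v, hu.add hv, (Lp.coeFn_add f g).trans (hfu.add hgv),
      fun j => by simp [hu0, hv0]⟩
  smul_mem' := by
    rintro c f ⟨hf, u, hu, hfu, hu0⟩
    exact ⟨W22.smul_mem c hf, c • u, hu.const_smul c,
      (Lp.coeFn_smul c f).trans (hfu.const_smul c), fun j => by simp [hu0]⟩

/-- The minimal Schrödinger operator `H = -Δ`,
`dom H = {f ∈ W^{2,2}(ℝ²) : f(x_j) = 0 for all j}`. -/
def minimalOperator {m : ℕ} (x : Fin m → Plane) : L2 →ₗ.[ℂ] L2 where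
  domain := minimalDomain x
  toFun :=
    { toFun := fun f => (exists_neg_laplacian f.2.1).choose
      map_add' := fun f g => toDist_injective <| by
        have h := fun f : minimalDomain x => (exists_neg_laplacian f.2.1).choose_spec
        rw [h (f + g), map_add, h f, h g, Submodule.coe_add, map_add,
          ← TemperedDistribution.laplacianCLM_apply, map_add, neg_add]
        simp only [TemperedDistribution.laplacianCLM_apply]
      map_smul' := fun c f => toDist_injective <| by
        have h := fun f : minimalDomain x => (exists_neg_laplacian f.2.1).choose_spec
        rw [RingHom.id_apply, h (c • f), map_smul, h f, Submodule.coe_smul, map_smul,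
          ← TemperedDistribution.laplacianCLM_apply, map_smul, smul_neg]
        simp only [TemperedDistribution.laplacianCLM_apply] }

theorem toDist_minimalOperator {m : ℕ} (x : Fin m → Plane) (f : (minimalOperator x).domain) :
    toDist (minimalOperator x f) = -Δ (toDist f) :=
  (exists_neg_laplacian f.2.1).choose_spec

/-- A boundary triplet of `H*` with the space `ℂ^m` whose maps are given by
`Γ₀ f = -2π {lim_{y → x_j} f(y) / ln|y - x_j|}_j` and
`Γ₁ f = {lim_{y → x_j} (f(y) - ξ_j ln|y - x_j|)}_j`, where
`ξ_j = lim_{y → x_j} f(y) / ln|y - x_j|`. All these limits exist, and the values of `f` are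
those of its representative `u` that is continuous off the points `x_j`. -/
def IsPointTriplet {m : ℕ} (x : Fin m → Plane)
    (T : BoundaryTriplet (minimalOperator x) (EuclideanSpace ℂ (Fin m))) : Prop :=
  ∀ f : (minimalOperator x)†.domain, ∃ u : Plane → ℂ, ∃ ξ : Fin m → ℂ,
    (f : L2) =ᵐ[volume] u ∧ ContinuousOn u (Set.range x)ᶜ ∧ ∀ j,
      Tendsto (fun y => u y / (Real.log ‖y - x j‖ : ℂ)) (𝓝[≠] x j) (𝓝 (ξ j)) ∧
      T.Γ₀ f j = -2 * Real.pi * ξ j ∧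
      Tendsto (fun y => u y - (Real.log ‖y - x j‖ : ℂ) * ξ j) (𝓝[≠] x j) (𝓝 (T.Γ₁ f j))

/-- The branch of the square root on `ℂ ∖ [0, ∞)` with positive imaginary part, that is
`√(r e^{iθ}) = √r e^{iθ/2}` for `r > 0` and `0 < θ < 2π`. On the open upper half-plane it is the
principal branch. -/
def sqrtUp (z : ℂ) : ℂ := Complex.I * (-z) ^ (1 / 2 : ℂ)

/-- The Hankel function `H₀⁽¹⁾` of the first kind and order zero on the open upper half-plane
`0 < Im w`, by its standard integral representation
`H₀⁽¹⁾(w) = (2 / (π i)) ∫_0^∞ exp(i w cosh t) dt`. -/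
def hankel (w : ℂ) : ℂ :=
  2 / (Real.pi * Complex.I) * ∫ t in Set.Ioi (0 : ℝ), Complex.exp (Complex.I * w * Real.cosh t)

/-- The matrix with the diagonal entries `(1 / 2π) (ψ(1) - ln(√z / 2i))` and the entries
`(i / 4) H₀⁽¹⁾(√z |x_j - x_k|)` off the diagonal, where `ψ = Γ' / Γ`. -/
def weylMatrix {m : ℕ} (x : Fin m → Plane) (z : ℂ) : Matrix (Fin m) (Fin m) ℂ :=
  Matrix.of fun j k =>
    if j = k then
      1 / (2 * Real.pi) * (Complex.digamma 1 - Complex.log (sqrtUp z / (2 * Complex.I)))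
    else Complex.I / 4 * hankel (sqrtUp z * ‖x j - x k‖)

end PointInteraction

end

noncomputable section

namespace PointInteraction

open BoundaryTriplets

/-! Put `z = -k²` with `k = (-z)^(1/2)`, so that `Re k > 0`, `√z = ik`, and `(i/4) H₀⁽¹⁾(√z r)` is
the function `K₀(kr)/2π` called `radialGreen`. Write `G_k` for the corresponding function `green k`
on the plane. Two analytic facts about it carry the proof. It is the kernel of the free resolvent
`R_k = (-Δ + k²)⁻¹`. Its Fourier transform is computed from the heat kernel for real `k` and
continued analytically; density of Schwartz functions then gives `coeFn_freeResolvent`. Since `G_k`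
is in `L²`, evaluation at a point becomes an inner product with a translate of a Green function.
Near the origin it is `-(1/2π) ln|y| + (1/2π)(ψ(1) - ln(k/2)) + o(1)`
(`tendsto_radialGreen_add_log`); this constant is the diagonal of the Weyl matrix.

The rest is linear algebra in `L²`, done at `k = 1`. With `G_j = G_1(· - x_j)`, `dom H` is the image
under `R_1` of the orthogonal complement of the `G_j`. By duality `dom H*` consists of the functions
`f = R_1 v + ∑ a_j G_j`, with `H* f = v - f` (`mem_adjoint_domain_iff_maxParam`,
`adjoint_apply_maxParam`). The logarithmic singularities determine `a`, and then `R_1` determines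
`v`. In these coordinates `Γ₀ f = a`, while `Γ₁ f` is the vector of values `(R_1 v)(x_j)` plus a
Hermitian matrix applied to `a`. The Green identity says that `a ↦ ∑ a_j G_j` and `v ↦ ((R_1
v)(x_j))_j` are adjoint to each other.

Any triplet with the prescribed limits has these boundary values, because the expansion depends only
on the `L²` class (`HasLogExpansion.unique`). Hence `ker Γ₀ = W^{2,2}`, `H_0` is the free Laplacian
and `R_k` is its resolvent at `-k²`. Finally `∑ a_j G_k(· - x_j)` lies in `𝔑_z` and has `Γ₀`-value
`a`, so it is `γ(z) a`, and its finite parts give `M(z) a`. -/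

/-! ### Analytic continuation in `k` and the logarithmic Laplace integral -/

open Complex in
theorem differentiableAt_integral_cexp_neg_mul {α : Type*} [MeasurableSpace α] {μ : Measure α}
    {g : α → ℂ} {h : α → ℝ} (hg : AEStronglyMeasurable g μ) (hh : AEMeasurable h μ)
    (h0 : ∀ᵐ a ∂μ, 0 ≤ h a)
    (hint : ∀ c : ℝ, 0 < c → Integrable (fun a => Real.exp (-(c * h a)) * ‖g a‖) μ)
    {k : ℂ} (hk : 0 < k.re) :
    DifferentiableAt ℂ (fun k : ℂ => ∫ a, cexp (-(k * h a)) * g a ∂μ) k := by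
  have hh' : AEStronglyMeasurable (fun a => (h a : ℂ)) μ :=
    (Complex.measurable_ofReal.comp_aemeasurable hh).aestronglyMeasurable
  have hm : ∀ k : ℂ, AEStronglyMeasurable (fun a => cexp (-(k * h a))) μ := fun k =>
    Complex.continuous_exp.comp_aestronglyMeasurable (hh'.const_mul k).neg
  have hnorm : ∀ (k : ℂ) a, ‖cexp (-(k * h a))‖ = Real.exp (-(k.re * h a)) := fun k a => by
    rw [Complex.norm_exp]; simp
  have hs : {w : ℂ | k.re / 2 < w.re} ∈ 𝓝 k :=
    (isOpen_lt continuous_const Complex.continuous_re).mem_nhds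
      (show k.re / 2 < k.re by linarith)
  refine (hasDerivAt_integral_of_dominated_loc_of_deriv_le
    (F' := fun k a => cexp (-(k * h a)) * (-(h a : ℂ)) * g a)
    (bound := fun a => 4 / k.re * (Real.exp (-(k.re / 4 * h a)) * ‖g a‖)) hs
    (Eventually.of_forall fun w => (hm w).mul hg) ?_ (((hm k).mul hh'.neg).mul hg) ?_
    ((hint _ (by linarith)).const_mul _) ?_).2.differentiableAt
  · refine (hint _ hk).mono' ((hm k).mul hg) (Eventually.of_forall fun a => ?_)
    rw [Pi.mul_apply, norm_mul, hnorm]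
  · filter_upwards [h0] with a ha w hw
    rw [norm_mul, norm_mul, hnorm, norm_neg, Complex.norm_real, Real.norm_of_nonneg ha, ← mul_assoc]
    refine mul_le_mul_of_nonneg_right ?_ (norm_nonneg _)
    -- Differentiation in `k` produces a factor `h a`. On `Re w > Re k / 2` it is absorbed by half
    -- of the remaining decay, using `s ≤ e^s`.
    have h1 : k.re / 4 * h a ≤ Real.exp (k.re / 4 * h a) := by
      linarith [Real.add_one_le_exp (k.re / 4 * h a)]
    calc Real.exp (-(w.re * h a)) * h a
        ≤ Real.exp (-(k.re / 2 * h a)) * (4 / k.re * Real.exp (k.re / 4 * h a)) := by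
          have : h a ≤ 4 / k.re * Real.exp (k.re / 4 * h a) := by
            calc h a = 4 / k.re * (k.re / 4 * h a) := by field_simp
              _ ≤ _ := by gcongr
          gcongr
      _ = 4 / k.re * Real.exp (-(k.re / 4 * h a)) := by
          rw [mul_left_comm, ← Real.exp_add]; congr 2; ring
  · refine Eventually.of_forall fun a w _ => ?_
    have := (((hasDerivAt_id w).mul_const (h a : ℂ)).neg.cexp).mul_const (g a)
    simpa using this

/-- Identity theorem on the right half-plane: the positive reals accumulate at the interior point
`1`. It carries formulas proved for real `k` over to complex `k`. -/
theorem eq_of_eq_ofReal {f g : ℂ → ℂ} (hf : ∀ k : ℂ, 0 < k.re → DifferentiableAt ℂ f k)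
    (hg : ∀ k : ℂ, 0 < k.re → DifferentiableAt ℂ g k)
    (h : ∀ c : ℝ, 0 < c → f c = g c) {k : ℂ} (hk : 0 < k.re) : f k = g k := by
  have ho : IsOpen {w : ℂ | 0 < w.re} := isOpen_lt continuous_const Complex.continuous_re
  have hc : IsPreconnected {w : ℂ | 0 < w.re} :=
    (convex_halfSpace_re_gt 0).isPreconnected
  refine AnalyticOnNhd.eqOn_of_preconnected_of_frequently_eq (z₀ := 1)
    (DifferentiableOn.analyticOnNhd (fun w hw => (hf w hw).differentiableWithinAt) ho)
    (DifferentiableOn.analyticOnNhd (fun w hw => (hg w hw).differentiableWithinAt) ho)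
    hc (show (0 : ℝ) < (1 : ℂ).re by simp) ?_ hk
  have ht : Tendsto (fun c : ℝ => (c : ℂ)) (𝓝[>] 1) (𝓝[≠] 1) := by
    refine tendsto_nhdsWithin_iff.2 ⟨?_, ?_⟩
    · exact (Complex.continuous_ofReal.tendsto' 1 1 (by simp)).mono_left nhdsWithin_le_nhds
    · filter_upwards [self_mem_nhdsWithin] with c hc
      have : (1 : ℝ) < c := hc
      simp only [Set.mem_compl_iff, Set.mem_singleton_iff]
      exact_mod_cast this.ne'
  refine ht.frequently (Eventually.frequently ?_)
  filter_upwards [self_mem_nhdsWithin] with c hc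
  exact h c (lt_trans one_pos hc)

/-- The factor `log v` comes from differentiating the Mellin transform `c^(-s) Γ(s)` of `e^(-cv)` at
`s = 1`; the digamma value enters here. -/
theorem integrableOn_log_mul_exp_neg_mul {c : ℝ} (hc : 0 < c) :
    IntegrableOn (fun v : ℝ => Real.log v * Real.exp (-(c * v))) (Set.Ioi 0) ∧
      ∫ v : ℝ in Set.Ioi 0, Complex.exp (-((c : ℂ) * v)) * (Real.log v : ℂ) =
        1 / c * (Complex.digamma 1 - Complex.log c) := by
  have hc' : (c : ℂ) ≠ 0 := by exact_mod_cast hc.ne'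
  set f : ℝ → ℂ := fun v => Complex.exp (-((c : ℂ) * v)) with hfdef
  have hfc : Continuous f := by fun_prop
  have key := mellin_hasDerivAt_of_isBigO_rpow (a := 2) (b := 0) (f := f) (s := 1)
    (hfc.continuousOn.locallyIntegrableOn measurableSet_Ioi) ?_ (by norm_num) ?_ (by norm_num)
  · obtain ⟨h1, h2⟩ := key
    constructor
    · have h3 := h1.re
      refine IntegrableOn.congr_fun h3 (fun v hv => ?_) measurableSet_Ioi
      simp [f, ← Complex.ofReal_mul, ← Complex.ofReal_neg, Complex.exp_ofReal_re]
    · have h3 : HasDerivAt (fun s : ℂ => (1 / (c : ℂ)) ^ s * Complex.Gamma s)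
          ((1 / (c : ℂ)) ^ (1 : ℂ) * Complex.log (1 / c) * 1 * Complex.Gamma 1 +
            (1 / (c : ℂ)) ^ (1 : ℂ) * deriv Complex.Gamma 1) 1 := by
        refine HasDerivAt.mul ?_ ?_
        · exact (hasDerivAt_id (1 : ℂ)).const_cpow (Or.inl (by simp [hc']))
        · refine (Complex.differentiableAt_Gamma 1 fun m hm => ?_).hasDerivAt
          have : (1 : ℝ) = -m := by exact_mod_cast hm
          have hm0 : (0 : ℝ) ≤ m := m.cast_nonneg
          linarith
      have h4 : mellin f =ᶠ[𝓝 1] fun s : ℂ => (1 / (c : ℂ)) ^ s * Complex.Gamma s := by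
        have : {s : ℂ | 0 < s.re} ∈ 𝓝 (1 : ℂ) :=
          (isOpen_lt continuous_const Complex.continuous_re).mem_nhds (by simp)
        filter_upwards [this] with s hs
        exact Complex.integral_cpow_mul_exp_neg_mul_Ioi hs hc
      have h5 := h2.unique (h3.congr_of_eventuallyEq h4)
      have h6 : mellin (fun t => Real.log t • f t) 1 =
          ∫ v : ℝ in Set.Ioi 0, Complex.exp (-((c : ℂ) * v)) * (Real.log v : ℂ) := by
        simp only [mellin, f]
        refine setIntegral_congr_fun measurableSet_Ioi fun v hv => ?_
        simp [mul_comm]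
      rw [← h6, h5, Complex.digamma_def, logDeriv_apply, Complex.Gamma_one, one_div,
        Complex.log_inv _ (by rw [Complex.arg_ofReal_of_nonneg hc.le]; exact Real.pi_pos.ne)]
      simp
      ring
  · have h1 : f =O[atTop] fun v : ℝ => Real.exp (-c * v) := by
      refine Asymptotics.isBigO_of_le _ fun v => ?_
      rw [hfdef]
      simp [Complex.norm_exp]
    exact h1.trans (isLittleO_exp_neg_mul_rpow_atTop hc _).isBigO
  · simp only [neg_zero, Real.rpow_zero]
    exact (hfc.continuousWithinAt (x := 0)).tendsto.isBigO_one ℝ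

theorem integral_cexp_neg_mul_mul_log {k : ℂ} (hk : 0 < k.re) :
    ∫ v : ℝ in Set.Ioi 0, Complex.exp (-(k * v)) * (Real.log v : ℂ) =
        1 / k * (Complex.digamma 1 - Complex.log k) := by
  refine eq_of_eq_ofReal (f := fun k => ∫ v : ℝ in Set.Ioi 0,
    Complex.exp (-(k * v)) * (Real.log v : ℂ))
    (g := fun k => 1 / k * (Complex.digamma 1 - Complex.log k)) (fun k hk => ?_) (fun k hk => ?_)
    (fun c hc => (integrableOn_log_mul_exp_neg_mul hc).2) hk
  · refine differentiableAt_integral_cexp_neg_mul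
      (Complex.measurable_ofReal.comp Real.measurable_log).aestronglyMeasurable aemeasurable_id
      ((ae_restrict_iff' measurableSet_Ioi).2 (Eventually.of_forall fun v hv => le_of_lt hv))
      (fun c hc => ?_) hk
    have := (integrableOn_log_mul_exp_neg_mul hc).1.norm
    refine IntegrableOn.congr_fun this (fun v hv => ?_) measurableSet_Ioi
    simp [mul_comm, Complex.norm_real]
  · have h0 : k ≠ 0 := by rintro rfl; simp at hk
    have hs : k ∈ Complex.slitPlane := Or.inl hk
    exact ((differentiableAt_const _).div differentiableAt_id h0).mul
      ((differentiableAt_const _).sub (Complex.differentiableAt_log hs))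

/-! ### The Green function: bounds, continuity, integrability -/

/-- The Green function of `-Δ + k²` at distance `r`, that is `K₀(k r) / 2π`. -/
def radialGreen (k : ℂ) (r : ℝ) : ℂ :=
  1 / (2 * Real.pi) * ∫ t in Set.Ioi (0 : ℝ), Complex.exp (-k * r * Real.cosh t)

/-- The Green function of `-Δ + k²` on the plane with its singularity at the origin. -/
def green (k : ℂ) (y : Plane) : ℂ := radialGreen k ‖y‖

theorem norm_cexp_neg_mul_cosh (k : ℂ) (r t : ℝ) :
    ‖Complex.exp (-k * r * Real.cosh t)‖ = Real.exp (-(k.re * r * Real.cosh t)) := by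
  rw [Complex.norm_exp]
  congr 1
  rw [mul_assoc, ← Complex.ofReal_mul, Complex.re_mul_ofReal, Complex.neg_re]
  ring

/-- Half of `a cosh t` is at least `a/2`; the other half is at least `c = a e^t / 4`, and `c ≥ log
c`. The resulting singularity `a^(-1/2)` is cruder than the true logarithm but square integrable on
the plane, and one bound serves integrability in `t`, in `y` and jointly. -/
theorem exp_neg_mul_cosh_le {a : ℝ} (ha : 0 < a) (t : ℝ) :
    Real.exp (-(a * Real.cosh t)) ≤
      2 * (a ^ (-(1 / 2) : ℝ) * Real.exp (-(a / 2))) * Real.exp (-(1 / 2) * t) := by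
  have h2 : (2 : ℝ) = Real.exp (Real.log 2) := (Real.exp_log two_pos).symm
  rw [Real.rpow_def_of_pos ha]
  nth_rewrite 1 [h2]
  rw [← Real.exp_add, ← Real.exp_add, ← Real.exp_add]
  apply Real.exp_le_exp.2
  have h1 : 1 ≤ Real.cosh t := Real.one_le_cosh t
  have h3 : Real.exp t ≤ 2 * Real.cosh t := by
    rw [Real.cosh_eq]; linarith [Real.exp_pos (-t)]
  set c := a * Real.exp t / 4 with hc
  have hc0 : 0 < c := by positivity
  have h4 : Real.log c = Real.log a + t - 2 * Real.log 2 := by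
    rw [hc, Real.log_div (by positivity) (by norm_num), Real.log_mul ha.ne' (Real.exp_ne_zero _),
      Real.log_exp, show (4 : ℝ) = 2 ^ 2 by norm_num, Real.log_pow]
    norm_num
  have h5 : Real.log c ≤ c := by linarith [Real.log_le_sub_one_of_pos hc0]
  have h6 : a ≤ a * Real.cosh t := by nlinarith
  have h7 : c ≤ a * Real.cosh t / 2 := by rw [hc]; nlinarith
  linarith

theorem integrableOn_cexp_neg_mul_cosh {k : ℂ} (hk : 0 < k.re) {r : ℝ} (hr : 0 < r) :
    IntegrableOn (fun t : ℝ => Complex.exp (-k * r * Real.cosh t)) (Set.Ioi 0) := by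
  refine Integrable.mono' ((integrableOn_exp_mul_Ioi (a := -(1 / 2)) (by norm_num) 0).const_mul
    (2 * ((k.re * r) ^ (-(1 / 2) : ℝ) * Real.exp (-(k.re * r / 2)))))
    (by fun_prop) (Eventually.of_forall fun t => ?_)
  rw [norm_cexp_neg_mul_cosh]
  exact exp_neg_mul_cosh_le (mul_pos hk hr) t

theorem norm_radialGreen_le {k : ℂ} (hk : 0 < k.re) {r : ℝ} (hr : 0 < r) :
    ‖radialGreen k r‖ ≤ 2 * ((k.re * r) ^ (-(1 / 2) : ℝ) * Real.exp (-(k.re * r / 2))) := by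
  have h1 : ‖∫ t in Set.Ioi (0 : ℝ), Complex.exp (-k * r * Real.cosh t)‖ ≤
      ∫ t in Set.Ioi (0 : ℝ), 2 * ((k.re * r) ^ (-(1 / 2) : ℝ) * Real.exp (-(k.re * r / 2))) *
        Real.exp (-(1 / 2) * t) := by
    refine norm_integral_le_of_norm_le ((integrableOn_exp_mul_Ioi (by norm_num) 0).const_mul _)
      (Eventually.of_forall fun t => ?_)
    rw [norm_cexp_neg_mul_cosh]
    exact exp_neg_mul_cosh_le (mul_pos hk hr) t
  rw [integral_const_mul, integral_exp_mul_Ioi (by norm_num)] at h1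
  set B := 2 * ((k.re * r) ^ (-(1 / 2) : ℝ) * Real.exp (-(k.re * r / 2)))
  have hB : 0 ≤ B := by have := mul_pos hk hr; positivity
  rw [radialGreen, norm_mul]
  have h2 : ‖(1 / (2 * Real.pi) : ℂ)‖ = 1 / (2 * Real.pi) := by
    simp [abs_of_pos Real.pi_pos]
  rw [h2]
  norm_num at h1
  have hpi := Real.pi_gt_three
  calc 1 / (2 * Real.pi) * ‖∫ t in Set.Ioi (0 : ℝ), Complex.exp (-k * r * Real.cosh t)‖
      ≤ 1 / 2 * (B * 2) := by
        gcongr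
        · linarith
        · simpa using h1
    _ = B := by ring

theorem continuousOn_radialGreen {k : ℂ} (hk : 0 < k.re) :
    ContinuousOn (radialGreen k) (Set.Ioi 0) := by
  intro r hr
  have hr : 0 < r := hr
  refine ContinuousAt.continuousWithinAt (continuousAt_const.mul ?_)
  refine continuousAt_of_dominated
    (bound := fun t => Real.exp (-(k.re * (r / 2) * Real.cosh t)))
    (Eventually.of_forall fun r => by fun_prop) ?_ ?_
    (Eventually.of_forall fun t => by fun_prop)
  · filter_upwards [lt_mem_nhds (half_lt_self hr)] with s hs
    refine Eventually.of_forall fun t => ?_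
    rw [norm_cexp_neg_mul_cosh]
    have := Real.cosh_pos t
    gcongr
  · have := (integrableOn_cexp_neg_mul_cosh hk (half_pos hr)).norm
    simpa only [norm_cexp_neg_mul_cosh] using this

theorem continuousOn_green {k : ℂ} (hk : 0 < k.re) : ContinuousOn (green k) {0}ᶜ :=
  (continuousOn_radialGreen hk).comp continuous_norm.continuousOn fun y hy => by
    simpa using hy

theorem integrable_rpow_norm_mul_exp {s c : ℝ} (hs : -2 < s) (hc : 0 < c) :
    Integrable (fun y : Plane => ‖y‖ ^ s * Real.exp (-(c * ‖y‖))) := by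
  refine (integrable_fun_norm_addHaar (volume : Measure Plane)
    (f := fun r => r ^ s * Real.exp (-(c * r)))).2 ?_
  have h := integrableOn_rpow_mul_exp_neg_mul_rpow (p := 1) (s := s + 1) (b := c)
    (by linarith) one_pos hc
  refine h.congr_fun (fun r hr => ?_) measurableSet_Ioi
  have hr : 0 < r := hr
  simp [Real.rpow_add_one hr.ne']
  ring

theorem aestronglyMeasurable_green {k : ℂ} (hk : 0 < k.re) :
    AEStronglyMeasurable (green k) (volume : Measure Plane) := by
  have h := (continuousOn_green hk).aestronglyMeasurable (μ := (volume : Measure Plane))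
    (measurableSet_singleton 0).compl
  rwa [Measure.restrict_eq_self_of_ae_mem] at h
  exact (measure_eq_zero_iff_ae_notMem.1 (measure_singleton (0 : Plane)))

theorem ae_norm_green_le {k : ℂ} (hk : 0 < k.re) : ∀ᵐ y : Plane, ‖green k y‖ ≤
    2 * k.re ^ (-(1 / 2) : ℝ) * (‖y‖ ^ (-(1 / 2) : ℝ) * Real.exp (-(k.re / 2 * ‖y‖))) := by
  filter_upwards [measure_eq_zero_iff_ae_notMem.1 (measure_singleton (0 : Plane))] with y hy
  have hy : 0 < ‖y‖ := by simpa using hy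
  refine (norm_radialGreen_le hk hy).trans_eq ?_
  rw [Real.mul_rpow hk.le hy.le]
  ring_nf

theorem integrable_green {k : ℂ} (hk : 0 < k.re) : Integrable (green k) :=
  ((integrable_rpow_norm_mul_exp (by norm_num) (half_pos hk)).const_mul _).mono'
    (aestronglyMeasurable_green hk) (ae_norm_green_le hk)

theorem memLp_green {k : ℂ} (hk : 0 < k.re) : MemLp (green k) 2 (volume : Measure Plane) := by
  rw [memLp_two_iff_integrable_sq_norm (aestronglyMeasurable_green hk)]
  refine ((integrable_rpow_norm_mul_exp (s := -1) (by norm_num) hk).const_mul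
    ((2 * k.re ^ (-(1 / 2) : ℝ)) ^ 2)).mono' ((aestronglyMeasurable_green hk).norm.pow 2) ?_
  filter_upwards [ae_norm_green_le hk] with y hy
  rw [Real.norm_of_nonneg (by positivity)]
  refine (pow_le_pow_left₀ (norm_nonneg _) hy 2).trans_eq ?_
  rw [mul_pow, mul_pow (‖y‖ ^ _)]
  congr 2
  · rw [← Real.rpow_natCast, ← Real.rpow_mul (norm_nonneg _)]
    norm_num
  · rw [← Real.exp_nat_mul]
    congr 1
    push_cast
    ring

theorem conj_radialGreen (k : ℂ) (r : ℝ) :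
    starRingEnd ℂ (radialGreen k r) = radialGreen (starRingEnd ℂ k) r := by
  simp only [radialGreen, map_mul, ← integral_conj, ← Complex.exp_conj, map_neg,
    Complex.conj_ofReal, map_div₀, map_one, map_ofNat]

theorem conj_green (k : ℂ) (y : Plane) :
    starRingEnd ℂ (green k y) = green (starRingEnd ℂ k) y :=
  conj_radialGreen k _

theorem green_neg (k : ℂ) (y : Plane) : green k (-y) = green k y := by simp [green]

/-- Since `√z = ik`, the exponent `i √z r cosh t` is `-k r cosh t`. From here on only `k` with `Re k
> 0` is needed. -/
theorem hankel_sqrtUp_mul (z : ℂ) (r : ℝ) :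
    Complex.I / 4 * hankel (sqrtUp z * r) = radialGreen ((-z) ^ (1 / 2 : ℂ)) r := by
  rw [hankel, radialGreen, ← mul_assoc]
  congr 1
  · have := Complex.I_ne_zero
    have : (Real.pi : ℂ) ≠ 0 := by exact_mod_cast Real.pi_ne_zero
    field_simp
    ring
  · congr 1
    ext t
    congr 1
    rw [sqrtUp]
    linear_combination ((-z) ^ (1 / 2 : ℂ) * r * Real.cosh t) * Complex.I_mul_I

/-! ### The logarithmic singularity of the Green function and its finite part -/

theorem integrableOn_log_add_mul_cexp {k : ℂ} (hk : 0 < k.re) (c : ℝ) :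
    IntegrableOn (fun v : ℝ => (|Real.log v| + c) * (‖k‖ * Real.exp (-(k.re * v)))) (Set.Ioi 0) := by
  have h1 : IntegrableOn (fun v : ℝ => ‖k‖ * (|Real.log v| * Real.exp (-(k.re * v))))
      (Set.Ioi 0) := by
    refine Integrable.const_mul ?_ _
    refine IntegrableOn.congr_fun (integrableOn_log_mul_exp_neg_mul hk).1.norm (fun v hv => ?_)
      measurableSet_Ioi
    simp
  have h2 : IntegrableOn (fun v : ℝ => c * ‖k‖ * Real.exp (-k.re * v)) (Set.Ioi 0) :=
    (integrableOn_exp_mul_Ioi (by linarith) 0).const_mul _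
  refine IntegrableOn.congr_fun (h1.add h2) (fun v hv => ?_) measurableSet_Ioi
  simp only [Pi.add_apply, neg_mul]
  ring

theorem abs_log_add_sqrt_le {r v : ℝ} (hr : 0 < r) (hv : r < v) :
    |Real.log (v + √(v ^ 2 - r ^ 2))| ≤ |Real.log v| + Real.log 2 := by
  have hv0 : 0 < v := hr.trans hv
  have h0 := Real.sqrt_nonneg (v ^ 2 - r ^ 2)
  have h1 : √(v ^ 2 - r ^ 2) ≤ v := by
    rw [Real.sqrt_le_left hv0.le]
    nlinarith
  have h2 : Real.log v ≤ Real.log (v + √(v ^ 2 - r ^ 2)) := Real.log_le_log hv0 (by linarith)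
  have h3 : Real.log (v + √(v ^ 2 - r ^ 2)) ≤ Real.log 2 + Real.log v := by
    rw [← Real.log_mul two_ne_zero hv0.ne']
    exact Real.log_le_log (by linarith) (by linarith)
  have h4 := Real.log_pos one_lt_two
  rw [abs_le]
  constructor <;> cases abs_cases (Real.log v) <;> linarith

theorem integrableOn_log_add_sqrt {k : ℂ} (hk : 0 < k.re) {r : ℝ} (hr : 0 < r) :
    IntegrableOn (fun v : ℝ => (Real.log (v + √(v ^ 2 - r ^ 2)) : ℂ) *
      (k * Complex.exp (-k * v))) (Set.Ioi r) := by
  refine Integrable.mono' ((integrableOn_log_add_mul_cexp hk (Real.log 2)).mono_set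
    (Set.Ioi_subset_Ioi hr.le)) (by fun_prop) ?_
  refine (ae_restrict_iff' measurableSet_Ioi).2 (Eventually.of_forall fun v hv => ?_)
  rw [norm_mul, norm_mul, Complex.norm_real, Complex.norm_exp]
  simp only [neg_mul, Complex.neg_re, Complex.re_mul_ofReal, Real.norm_eq_abs]
  gcongr
  exact abs_log_add_sqrt_le hr hv

theorem image_mul_cosh_Ioi {r : ℝ} (hr : 0 < r) :
    (fun t => r * Real.cosh t) '' Set.Ioi 0 = Set.Ioi r := by
  ext v
  simp only [Set.mem_image, Set.mem_Ioi]
  constructor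
  · rintro ⟨t, ht, rfl⟩
    have := Real.one_lt_cosh.2 ht.ne'
    nlinarith
  · intro hv
    have h1 : 1 < v / r := (one_lt_div hr).2 hv
    refine ⟨Real.arcosh (v / r), Real.arcosh_pos h1, ?_⟩
    rw [Real.cosh_arcosh h1.le]
    field_simp

theorem log_mul_cosh_add_sqrt {r t : ℝ} (hr : 0 < r) (ht : 0 < t) :
    Real.log (r * Real.cosh t + √((r * Real.cosh t) ^ 2 - r ^ 2)) = Real.log r + t := by
  have h1 : (r * Real.cosh t) ^ 2 - r ^ 2 = (r * Real.sinh t) ^ 2 := by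
    rw [mul_pow, Real.cosh_sq]; ring
  rw [h1, Real.sqrt_sq (by have := Real.sinh_pos_iff.2 ht; positivity), ← mul_add,
    Real.cosh_add_sinh, Real.log_mul hr.ne' (Real.exp_ne_zero _), Real.log_exp]

/-- Integrate by parts against `t`, then substitute `v = r cosh t`, for which `t = log(v + √(v² -
r²)) - log r`. This isolates the singular term `log r`; the remaining integral converges as `r → 0`.
-/
theorem integral_cexp_neg_mul_cosh {k : ℂ} (hk : 0 < k.re) {r : ℝ} (hr : 0 < r) :
    ∫ t in Set.Ioi (0 : ℝ), Complex.exp (-k * r * Real.cosh t) =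
      (∫ v in Set.Ioi r, (Real.log (v + √(v ^ 2 - r ^ 2)) : ℂ) * (k * Complex.exp (-k * v))) -
        Real.log r * Complex.exp (-k * r) := by
  have hk0 : k ≠ 0 := by rintro rfl; simp at hk
  set g : ℝ → ℂ := fun v => ((Real.log (v + √(v ^ 2 - r ^ 2)) : ℂ) - Real.log r) *
    (k * Complex.exp (-k * v)) with hg
  have hk' : (-k).re < 0 := by simpa using hk
  have hexp := integral_exp_mul_complex_Ioi hk' r
  have hexpi : IntegrableOn (fun v : ℝ => (Real.log r : ℂ) * (k * Complex.exp (-k * v)))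
      (Set.Ioi r) := ((integrableOn_exp_mul_complex_Ioi hk' r).const_mul k).const_mul _
  have hgi : IntegrableOn g (Set.Ioi r) := by
    refine IntegrableOn.congr_fun ((integrableOn_log_add_sqrt hk hr).sub hexpi) (fun v _ => ?_)
      measurableSet_Ioi
    simp only [hg, Pi.sub_apply]
    ring
  have hgint : ∫ v in Set.Ioi r, g v =
      (∫ v in Set.Ioi r, (Real.log (v + √(v ^ 2 - r ^ 2)) : ℂ) * (k * Complex.exp (-k * v))) -
        Real.log r * Complex.exp (-k * r) := by
    have h1 : ∫ v in Set.Ioi r, (Real.log r : ℂ) * (k * Complex.exp (-k * v)) =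
        Real.log r * Complex.exp (-k * r) := by
      rw [integral_const_mul, integral_const_mul, hexp]
      field_simp
    rw [← h1, ← integral_sub (integrableOn_log_add_sqrt hk hr) hexpi]
    refine setIntegral_congr_fun measurableSet_Ioi fun v _ => ?_
    simp only [hg]
    ring
  rw [← hgint]
  have hder : ∀ t ∈ Set.Ioi (0 : ℝ), HasDerivWithinAt (fun t => r * Real.cosh t)
      (r * Real.sinh t) (Set.Ioi 0) t := fun t _ =>
    ((Real.hasDerivAt_cosh t).const_mul r).hasDerivWithinAt
  have hinj : Set.InjOn (fun t => r * Real.cosh t) (Set.Ioi 0) := fun s hs t ht h => by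
    have h' := mul_left_cancel₀ hr.ne' h
    exact Real.cosh_strictMonoOn.injOn (Set.mem_Ici.2 (le_of_lt hs)) (Set.mem_Ici.2 (le_of_lt ht)) h'
  have hcomp : ∀ t ∈ Set.Ioi (0 : ℝ), |r * Real.sinh t| • g (r * Real.cosh t) =
      -((t : ℂ) * (Complex.exp (-k * r * Real.cosh t) * (-k * r * Real.sinh t))) := fun t ht => by
    have h1 : 0 < r * Real.sinh t := mul_pos hr (Real.sinh_pos_iff.2 ht)
    rw [abs_of_pos h1, hg]
    simp only
    rw [log_mul_cosh_add_sqrt hr ht, Complex.real_smul]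
    push_cast
    rw [← mul_assoc (-k)]
    ring
  have hint := (integrableOn_image_iff_integrableOn_abs_deriv_smul measurableSet_Ioi hder hinj g).1
    (by rwa [image_mul_cosh_Ioi hr])
  have hint' : IntegrableOn (fun t : ℝ => (t : ℂ) *
      (Complex.exp (-k * r * Real.cosh t) * (-k * r * Real.sinh t))) (Set.Ioi 0) := by
    have := (hint.congr_fun hcomp measurableSet_Ioi).neg
    simpa using this
  rw [← image_mul_cosh_Ioi hr,
    integral_image_eq_integral_abs_deriv_smul measurableSet_Ioi hder hinj,
    setIntegral_congr_fun measurableSet_Ioi hcomp, integral_neg]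
  have hparts := integral_Ioi_mul_deriv_eq_deriv_mul (a := 0) (a' := 0) (b' := 0)
    (u := fun t : ℝ => (t : ℂ)) (u' := fun _ => 1)
    (v := fun t : ℝ => Complex.exp (-k * r * Real.cosh t))
    (v' := fun t : ℝ => Complex.exp (-k * r * Real.cosh t) * (-k * r * Real.sinh t))
    (fun t _ => Complex.ofRealCLM.hasDerivAt) (fun t _ => ?_) hint' ?_ ?_ ?_
  · rw [hparts]
    simp
  · exact (((Real.hasDerivAt_cosh t).ofReal_comp).const_mul (-k * r)).cexp
  · simpa [Pi.mul_def] using integrableOn_cexp_neg_mul_cosh hk hr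
  · have : Continuous ((fun t : ℝ => (t : ℂ)) *
        fun t : ℝ => Complex.exp (-k * r * Real.cosh t)) := by
      rw [Pi.mul_def]; fun_prop
    exact (this.tendsto' 0 0 (by simp)).mono_left nhdsWithin_le_nhds
  · refine squeeze_zero_norm' (a := fun t : ℝ =>
      2 * ((k.re * r) ^ (-(1 / 2) : ℝ) * Real.exp (-(k.re * r / 2))) *
        (t ^ (1 : ℝ) * Real.exp (-(1 / 2) * t))) ?_ ?_
    · filter_upwards [eventually_gt_atTop 0] with t ht
      rw [Pi.mul_apply, norm_mul, norm_cexp_neg_mul_cosh, Complex.norm_real,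
        Real.norm_of_nonneg ht.le, Real.rpow_one, mul_left_comm]
      gcongr
      exact exp_neg_mul_cosh_le (mul_pos hk hr) t
    · simpa using (tendsto_rpow_mul_exp_neg_mul_atTop_nhds_zero 1 (1 / 2) (by norm_num)).const_mul
        (2 * ((k.re * r) ^ (-(1 / 2) : ℝ) * Real.exp (-(k.re * r / 2))))

/-- Dominated convergence: the integrand tends to `log(2v) k e^(-kv)`, whose integral is known from
the logarithmic Laplace integral. -/
theorem tendsto_setIntegral_log_add_sqrt {k : ℂ} (hk : 0 < k.re) :
    Tendsto (fun r : ℝ => ∫ v in Set.Ioi r, (Real.log (v + √(v ^ 2 - r ^ 2)) : ℂ) *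
      (k * Complex.exp (-k * v))) (𝓝[>] 0) (𝓝 (Complex.digamma 1 - Complex.log (k / 2))) := by
  have hk0 : k ≠ 0 := by rintro rfl; simp at hk
  have hk' : (-k).re < 0 := by simpa using hk
  have hlim : ∫ v in Set.Ioi (0 : ℝ), ((Real.log 2 + Real.log v : ℝ) : ℂ) *
      (k * Complex.exp (-k * v)) = Complex.digamma 1 - Complex.log (k / 2) := by
    have h1 := integral_cexp_neg_mul_mul_log hk
    have h2 := integral_exp_mul_complex_Ioi hk' 0
    have i1 : IntegrableOn (fun v : ℝ => k * (Complex.exp (-(k * v)) * (Real.log v : ℂ)))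
        (Set.Ioi 0) := by
      refine Integrable.mono' (integrableOn_log_add_mul_cexp hk 0)
        (Measurable.aestronglyMeasurable (by fun_prop)) (Eventually.of_forall fun v => ?_)
      rw [norm_mul, norm_mul, Complex.norm_real, Complex.norm_exp]
      simp
      ring_nf
      rfl
    have i2 : IntegrableOn (fun v : ℝ => k * Real.log 2 * Complex.exp (-k * v)) (Set.Ioi 0) :=
      (integrableOn_exp_mul_complex_Ioi hk' 0).const_mul _
    have h3 : Complex.log (k / 2) = Complex.log k - Real.log 2 := by
      have := Complex.log_mul_ofReal (2⁻¹ : ℝ) (by norm_num) k hk0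
      rw [Real.log_inv] at this
      push_cast at this
      rw [div_eq_mul_inv, this]
      ring
    calc _ = ∫ v in Set.Ioi (0 : ℝ), (k * (Complex.exp (-(k * v)) * (Real.log v : ℂ)) +
          k * Real.log 2 * Complex.exp (-k * v)) := by
          refine setIntegral_congr_fun measurableSet_Ioi fun v _ => ?_
          push_cast
          ring_nf
      _ = _ := by
          rw [integral_add i1 i2, integral_const_mul, integral_const_mul, h1, h2, h3]
          simp
          field_simp
          ring
  rw [← hlim]
  -- The domain of integration moves with `r`, so indicators put all integrals on the whole line.
  simp_rw [← integral_indicator (μ := volume) (measurableSet_Ioi (a := (_ : ℝ)))]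
  refine tendsto_integral_filter_of_dominated_convergence
    ((Set.Ioi (0 : ℝ)).indicator fun v : ℝ =>
      (|Real.log v| + Real.log 2) * (‖k‖ * Real.exp (-(k.re * v)))) ?_ ?_ ?_ ?_
  · refine Eventually.of_forall fun r => AEStronglyMeasurable.indicator ?_ measurableSet_Ioi
    exact Measurable.aestronglyMeasurable (by fun_prop)
  · filter_upwards [self_mem_nhdsWithin] with r hr
    refine Eventually.of_forall fun v => ?_
    have hr : 0 < r := hr
    by_cases hv : r < v
    · rw [Set.indicator_of_mem (Set.mem_Ioi.2 hv), Set.indicator_of_mem (Set.mem_Ioi.2 (hr.trans hv)),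
        norm_mul, norm_mul, Complex.norm_real, Complex.norm_exp]
      simp only [neg_mul, Complex.neg_re, Complex.re_mul_ofReal, Real.norm_eq_abs]
      gcongr
      exact abs_log_add_sqrt_le hr hv
    · rw [Set.indicator_of_notMem (by simpa using hv), norm_zero]
      refine Set.indicator_nonneg (fun v hv => ?_) v
      have := Real.log_pos one_lt_two
      positivity
  · exact (integrable_indicator_iff measurableSet_Ioi).2
      (integrableOn_log_add_mul_cexp hk (Real.log 2))
  · refine Eventually.of_forall fun v => ?_
    by_cases hv : 0 < v
    · rw [Set.indicator_of_mem (Set.mem_Ioi.2 hv)]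
      have h1 : (fun r : ℝ => (Real.log (v + √(v ^ 2 - r ^ 2)) : ℂ) * (k * Complex.exp (-k * v)))
          =ᶠ[𝓝[>] 0] fun r => (Set.Ioi r).indicator (fun v : ℝ =>
            (Real.log (v + √(v ^ 2 - r ^ 2)) : ℂ) * (k * Complex.exp (-k * v))) v := by
        filter_upwards [nhdsWithin_le_nhds (gt_mem_nhds hv)] with r hr
        rw [Set.indicator_of_mem (Set.mem_Ioi.2 hr)]
      refine Tendsto.congr' h1 (Tendsto.mul_const _ ?_)
      refine (Complex.continuous_ofReal.tendsto _).comp ?_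
      have h2 : Real.log 2 + Real.log v = Real.log (v + √(v ^ 2 - 0 ^ 2)) := by
        rw [← Real.log_mul two_ne_zero hv.ne']
        congr 1
        rw [zero_pow two_ne_zero, sub_zero, Real.sqrt_sq hv.le]
        ring
      rw [h2]
      have h3 : ContinuousAt (fun r : ℝ => Real.log (v + √(v ^ 2 - r ^ 2))) 0 := by
        refine ContinuousAt.log (by fun_prop) ?_
        have := Real.sqrt_nonneg (v ^ 2 - 0 ^ 2)
        positivity
      exact h3.tendsto.mono_left nhdsWithin_le_nhds
    · rw [Set.indicator_of_notMem (by simpa using hv)]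
      refine tendsto_const_nhds.congr' ?_
      filter_upwards [self_mem_nhdsWithin] with r hr
      have hr : 0 < r := hr
      rw [Set.indicator_of_notMem]
      simp only [Set.mem_Ioi]
      intro h
      exact hv (hr.trans h)

/-- The factor `1 - e^(-kr)` is `O(r)` and beats the logarithm, so `log r · e^(-kr)` may be replaced
by `log r`. -/
theorem tendsto_log_mul_one_sub_cexp (k : ℂ) :
    Tendsto (fun r : ℝ => (Real.log r : ℂ) * (1 - Complex.exp (-k * r))) (𝓝[>] 0) (𝓝 0) := by
  have h1 : HasDerivAt (fun r : ℝ => 1 - Complex.exp (-k * r)) k 0 := by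
    have := ((((hasDerivAt_id (0 : ℝ)).ofReal_comp).const_mul (-k)).cexp).const_sub 1
    simpa using this
  have h2 := (hasDerivAt_iff_tendsto_slope.1 h1).mono_left
    (nhdsWithin_mono 0 (fun r (hr : 0 < r) => hr.ne'))
  have h3 : Tendsto (fun r : ℝ => ((Real.log r * r : ℝ) : ℂ)) (𝓝[>] 0) (𝓝 0) := by
    have := (Complex.continuous_ofReal.tendsto 0).comp (tendsto_log_mul_rpow_nhdsGT_zero one_pos)
    simpa [Function.comp_def] using this
  have h4 := h3.mul h2
  rw [zero_mul] at h4
  refine h4.congr' ?_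
  filter_upwards [self_mem_nhdsWithin] with r hr
  have hr : (r : ℂ) ≠ 0 := by exact_mod_cast (ne_of_gt hr)
  simp [slope, vsub_eq_sub]
  field_simp

theorem tendsto_radialGreen_add_log {k : ℂ} (hk : 0 < k.re) :
    Tendsto (fun r : ℝ => radialGreen k r + 1 / (2 * Real.pi) * Real.log r) (𝓝[>] 0)
      (𝓝 (1 / (2 * Real.pi) * (Complex.digamma 1 - Complex.log (k / 2)))) := by
  have h := ((tendsto_setIntegral_log_add_sqrt hk).add (tendsto_log_mul_one_sub_cexp k)).const_mul
    (1 / (2 * Real.pi) : ℂ)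
  rw [add_zero] at h
  refine h.congr' ?_
  filter_upwards [self_mem_nhdsWithin] with r hr
  rw [radialGreen, integral_cexp_neg_mul_cosh hk hr]
  ring

/-! ### The Fourier transform of the Green function -/

theorem integral_exp_neg_mul_cosh_eq {c r : ℝ} (hc : 0 < c) (hr : 0 < r) :
    ∫ t in Set.Ioi (0 : ℝ), Real.exp (-(c * r * Real.cosh t)) =
      1 / 2 * ∫ τ in Set.Ioi (0 : ℝ), τ⁻¹ * Real.exp (-(c ^ 2 * τ + r ^ 2 / (4 * τ))) := by
  -- This scale balances the exponent: for `τ = a e^s` the terms `c² τ` and `r²/(4τ)` are `(cr/2)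
  -- e^s` and `(cr/2) e^(-s)`, with sum `cr cosh s`.
  set a := r / (2 * c) with ha
  have ha0 : 0 < a := by positivity
  have himg : (fun s => a * Real.exp s) '' Set.univ = Set.Ioi 0 := by
    ext τ
    simp only [Set.image_univ, Set.mem_range, Set.mem_Ioi]
    constructor
    · rintro ⟨s, rfl⟩
      positivity
    · intro hτ
      refine ⟨Real.log (τ / a), ?_⟩
      rw [Real.exp_log (by positivity)]
      field_simp
  have h1 : ∫ t : ℝ, Real.exp (-(c * r * Real.cosh t)) =
      2 * ∫ t in Set.Ioi (0 : ℝ), Real.exp (-(c * r * Real.cosh t)) := by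
    simpa only [Real.cosh_abs] using
      integral_comp_abs (f := fun t => Real.exp (-(c * r * Real.cosh t)))
  rw [show ∫ t in Set.Ioi (0 : ℝ), Real.exp (-(c * r * Real.cosh t)) =
    1 / 2 * ∫ t : ℝ, Real.exp (-(c * r * Real.cosh t)) by rw [h1]; ring,
    ← himg, integral_image_eq_integral_abs_deriv_smul MeasurableSet.univ
    (fun s _ => ((Real.hasDerivAt_exp s).const_mul a).hasDerivWithinAt)
    (fun s _ t _ h => Real.exp_injective (mul_left_cancel₀ ha0.ne' h)), Measure.restrict_univ]
  have h2 : ∀ s : ℝ, |a * Real.exp s| • ((a * Real.exp s)⁻¹ *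
      Real.exp (-(c ^ 2 * (a * Real.exp s) + r ^ 2 / (4 * (a * Real.exp s))))) =
      Real.exp (-(c * r * Real.cosh s)) := fun s => by
    have h3 : 0 < a * Real.exp s := by positivity
    rw [abs_of_pos h3, smul_eq_mul, mul_inv_cancel_left₀ h3.ne']
    congr 2
    rw [Real.cosh_eq, Real.exp_neg, ha]
    field_simp
    ring
  simp only [h2]

theorem green_ofReal {c : ℝ} (hc : 0 < c) {y : Plane} (hy : y ≠ 0) :
    green c y = ∫ τ in Set.Ioi (0 : ℝ),
      (((4 * Real.pi * τ)⁻¹ * Real.exp (-(c ^ 2 * τ + ‖y‖ ^ 2 / (4 * τ))) : ℝ) : ℂ) := by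
  have hr : 0 < ‖y‖ := norm_pos_iff.2 hy
  have h1 : ∀ t : ℝ, Complex.exp (-(c : ℂ) * ‖y‖ * Real.cosh t) =
      (Real.exp (-(c * ‖y‖ * Real.cosh t)) : ℝ) := fun t => by
    push_cast
    congr 1
    ring
  rw [green, radialGreen, integral_complex_ofReal]
  simp only [h1]
  rw [integral_complex_ofReal, integral_exp_neg_mul_cosh_eq hc hr]
  have h2 : ∀ τ : ℝ, (4 * Real.pi * τ)⁻¹ * Real.exp (-(c ^ 2 * τ + ‖y‖ ^ 2 / (4 * τ))) =
      (4 * Real.pi)⁻¹ * (τ⁻¹ * Real.exp (-(c ^ 2 * τ + ‖y‖ ^ 2 / (4 * τ)))) := fun τ => by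
    rw [mul_inv, mul_assoc]
  simp only [h2]
  rw [integral_const_mul]
  push_cast
  ring

theorem integral_heatKernel {τ : ℝ} (hτ : 0 < τ) :
    Integrable (fun y : Plane => Real.exp (-(‖y‖ ^ 2 / (4 * τ)))) ∧
    ∫ y : Plane, Real.exp (-(‖y‖ ^ 2 / (4 * τ))) = 4 * Real.pi * τ ∧
    ∀ ξ : Plane, ∫ y : Plane, Complex.exp ((2 * Real.pi * inner ℝ y ξ : ℝ) * Complex.I) *
      (Real.exp (-(‖y‖ ^ 2 / (4 * τ))) : ℝ) =
        4 * Real.pi * τ * Complex.exp (-(4 * Real.pi ^ 2 * ‖ξ‖ ^ 2 * τ)) := by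
  have hb : 0 < (4 * τ)⁻¹ := by positivity
  have hbc : 0 < (((4 * τ)⁻¹ : ℝ) : ℂ).re := by rwa [Complex.ofReal_re]
  have hτ' : (τ : ℂ) ≠ 0 := by exact_mod_cast hτ.ne'
  have h1 : ∀ y : Plane, Real.exp (-(‖y‖ ^ 2 / (4 * τ))) = Real.exp (-(4 * τ)⁻¹ * ‖y‖ ^ 2) :=
    fun y => by congr 1; rw [div_eq_mul_inv]; ring
  have hfin : Module.finrank ℝ Plane = 2 := by simp
  have hint : ∀ ξ : Plane, ∫ y : Plane, Complex.exp ((2 * Real.pi * inner ℝ y ξ : ℝ) * Complex.I) *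
      (Real.exp (-(‖y‖ ^ 2 / (4 * τ))) : ℝ) =
        4 * Real.pi * τ * Complex.exp (-(4 * Real.pi ^ 2 * ‖ξ‖ ^ 2 * τ)) := fun ξ => by
    have h := GaussianFourier.integral_cexp_neg_mul_sq_norm_add hbc (2 * Real.pi * Complex.I) ξ
    rw [hfin] at h
    convert h using 1
    · congr 1
      ext y
      rw [h1, Complex.ofReal_exp, ← Complex.exp_add, real_inner_comm]
      congr 1
      push_cast
      ring
    · congr 1
      · norm_num
        field_simp
      · congr 1
        push_cast
        field_simp
        rw [Complex.I_sq]
        ring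
  refine ⟨?_, ?_, hint⟩
  · simp only [h1]
    have := GaussianFourier.integrable_cexp_neg_mul_sq_norm_add hbc 0 (0 : Plane)
    refine this.norm.congr (Eventually.of_forall fun y => ?_)
    simp only [Complex.norm_exp]
    congr 1
    simp [← Complex.ofReal_pow, ← Complex.ofReal_mul]
  · have h := hint 0
    simp only [inner_zero_right, mul_zero, Complex.ofReal_zero, zero_mul, Complex.exp_zero,
      one_mul, norm_zero] at h
    rw [integral_complex_ofReal] at h
    have h' : ((∫ y : Plane, Real.exp (-(‖y‖ ^ 2 / (4 * τ))) : ℝ) : ℂ) =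
        ((4 * Real.pi * τ : ℝ) : ℂ) := by
      rw [h]
      simp
    exact_mod_cast h'

/-- By `green_ofReal` the Green function is a Laplace transform of heat kernels. After Fubini each
Gaussian is transformed explicitly, leaving the integral of `e^(-(4π²|ξ|² + c²)τ)` over `τ`. -/
theorem integral_cexp_inner_mul_green_ofReal {c : ℝ} (hc : 0 < c) (ξ : Plane) :
    ∫ y : Plane, Complex.exp ((2 * Real.pi * inner ℝ y ξ : ℝ) * Complex.I) * green c y =
      1 / (4 * Real.pi ^ 2 * ‖ξ‖ ^ 2 + (c : ℂ) ^ 2) := by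
  set F : Plane → ℝ → ℂ := fun y τ => Complex.exp ((2 * Real.pi * inner ℝ y ξ : ℝ) * Complex.I) *
    (((4 * Real.pi * τ)⁻¹ * Real.exp (-(c ^ 2 * τ + ‖y‖ ^ 2 / (4 * τ))) : ℝ) : ℂ) with hF
  have hsplit : ∀ (y : Plane) (τ : ℝ), F y τ =
      ((4 * Real.pi * τ)⁻¹ * Real.exp (-(c ^ 2 * τ)) : ℝ) *
        (Complex.exp ((2 * Real.pi * inner ℝ y ξ : ℝ) * Complex.I) *
          (Real.exp (-(‖y‖ ^ 2 / (4 * τ))) : ℝ)) := fun y τ => by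
    simp only [hF]
    rw [neg_add, Real.exp_add]
    push_cast
    ring
  have hnorm : ∀ (y : Plane) (τ : ℝ), 0 < τ → ‖F y τ‖ =
      ((4 * Real.pi * τ)⁻¹ * Real.exp (-(c ^ 2 * τ))) * Real.exp (-(‖y‖ ^ 2 / (4 * τ))) :=
    fun y τ hτ => by
      have h0 : 0 ≤ (4 * Real.pi * τ)⁻¹ * Real.exp (-(c ^ 2 * τ)) := by positivity
      rw [hsplit, norm_mul, norm_mul, Complex.norm_exp_ofReal_mul_I, one_mul, Complex.norm_real,
        Complex.norm_real, Real.norm_of_nonneg h0, Real.norm_of_nonneg (Real.exp_nonneg _)]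
  have hmeas : Measurable (Function.uncurry F) := by
    simp only [hF, Function.uncurry_def]
    fun_prop
  have hexp : IntegrableOn (fun τ : ℝ => Real.exp (-(c ^ 2) * τ)) (Set.Ioi 0) :=
    integrableOn_exp_mul_Ioi (by have := pow_pos hc 2; linarith) 0
  have hFint : Integrable (Function.uncurry F) (volume.prod (volume.restrict (Set.Ioi 0))) := by
    rw [integrable_prod_iff' hmeas.aestronglyMeasurable]
    constructor
    · refine (ae_restrict_iff' measurableSet_Ioi).2 (Eventually.of_forall fun τ hτ => ?_)
      refine ((integral_heatKernel hτ).1.const_mul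
        ((4 * Real.pi * τ)⁻¹ * Real.exp (-(c ^ 2 * τ)))).mono'
        (hmeas.comp measurable_prodMk_right).aestronglyMeasurable
        (Eventually.of_forall fun y => ?_)
      exact (hnorm y τ hτ).le
    · refine hexp.congr_fun (fun τ hτ => ?_) measurableSet_Ioi
      have hτ : 0 < τ := hτ
      simp only [Function.uncurry_apply_pair, hnorm _ _ hτ]
      rw [integral_const_mul, (integral_heatKernel hτ).2.1]
      field_simp
  have h1 : ∫ y : Plane, Complex.exp ((2 * Real.pi * inner ℝ y ξ : ℝ) * Complex.I) * green c y =
      ∫ y : Plane, ∫ τ in Set.Ioi (0 : ℝ), F y τ := by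
    refine integral_congr_ae ?_
    filter_upwards [measure_eq_zero_iff_ae_notMem.1 (measure_singleton (0 : Plane))] with y hy
    rw [green_ofReal hc (by simpa using hy), ← integral_const_mul]
  rw [h1, integral_integral_swap hFint]
  have hre : (-(4 * Real.pi ^ 2 * ‖ξ‖ ^ 2 + (c : ℂ) ^ 2)).re < 0 := by
    rw [show (-(4 * Real.pi ^ 2 * ‖ξ‖ ^ 2 + (c : ℂ) ^ 2)) =
      ((-(4 * Real.pi ^ 2 * ‖ξ‖ ^ 2 + c ^ 2) : ℝ) : ℂ) by push_cast; ring, Complex.ofReal_re]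
    have : 0 < c ^ 2 := by positivity
    have : 0 ≤ 4 * Real.pi ^ 2 * ‖ξ‖ ^ 2 := by positivity
    linarith
  have h2 : ∀ τ ∈ Set.Ioi (0 : ℝ), ∫ y : Plane, F y τ =
      Complex.exp (-(4 * Real.pi ^ 2 * ‖ξ‖ ^ 2 + (c : ℂ) ^ 2) * τ) := fun τ hτ => by
    have hτ' : (τ : ℂ) ≠ 0 := by exact_mod_cast (ne_of_gt hτ)
    have hpi : (Real.pi : ℂ) ≠ 0 := by exact_mod_cast Real.pi_ne_zero
    simp only [hsplit]
    rw [integral_const_mul, (integral_heatKernel hτ).2.2 ξ]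
    push_cast
    rw [show (4 * (Real.pi : ℂ) * τ)⁻¹ * Complex.exp (-(c ^ 2 * τ)) * (4 * Real.pi * τ *
      Complex.exp (-(4 * Real.pi ^ 2 * ‖ξ‖ ^ 2 * τ))) =
        Complex.exp (-(c ^ 2 * τ)) * Complex.exp (-(4 * Real.pi ^ 2 * ‖ξ‖ ^ 2 * τ)) by
          field_simp, ← Complex.exp_add]
    congr 1
    ring
  rw [setIntegral_congr_fun measurableSet_Ioi h2, integral_exp_mul_complex_Ioi hre]
  simp only [Complex.ofReal_zero, mul_zero, Complex.exp_zero]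
  rw [div_neg, neg_div, neg_neg]

theorem integrable_exp_neg_mul_norm_mul_cosh {c : ℝ} (hc : 0 < c) :
    Integrable (fun p : Plane × ℝ => Real.exp (-(c * (‖p.1‖ * Real.cosh p.2))))
      (volume.prod (volume.restrict (Set.Ioi 0))) := by
  have h := ((integrable_rpow_norm_mul_exp (s := -(1 / 2)) (by norm_num) (half_pos hc)).const_mul
    (2 * c ^ (-(1 / 2) : ℝ))).mul_prod (integrableOn_exp_mul_Ioi (a := -(1 / 2)) (by norm_num) 0)
  refine h.mono' (Continuous.aestronglyMeasurable (by fun_prop)) ?_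
  filter_upwards [Measure.quasiMeasurePreserving_fst.ae
    (measure_eq_zero_iff_ae_notMem.1 (measure_singleton (0 : Plane)))] with p hp
  have hp : 0 < ‖p.1‖ := by simpa using hp
  rw [Real.norm_of_nonneg (Real.exp_nonneg _), ← mul_assoc]
  refine (exp_neg_mul_cosh_le (mul_pos hc hp) p.2).trans_eq ?_
  rw [Real.mul_rpow hc.le hp.le]
  ring_nf

/-- The symbol `1 / (4π²|ξ|² + k²)` of the resolvent of the Laplacian. -/
def resolventSymbol (k : ℂ) (ξ : Plane) : ℂ := 1 / (4 * Real.pi ^ 2 * ‖ξ‖ ^ 2 + k ^ 2)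

theorem symbol_ne_zero {k : ℂ} (hk : 0 < k.re) {s : ℝ} (hs : 0 ≤ s) : (s : ℂ) + k ^ 2 ≠ 0 := by
  intro h
  have h1 := congrArg Complex.re h
  have h2 := congrArg Complex.im h
  simp [pow_two] at h1 h2
  have h3 : k.im = 0 := by
    have : k.re * k.im = 0 := by linarith
    exact (mul_eq_zero.1 this).resolve_left hk.ne'
  rw [h3] at h1
  nlinarith

theorem laplacian_symbol_ne_zero {k : ℂ} (hk : 0 < k.re) (ξ : Plane) :
    (4 * Real.pi ^ 2 * ‖ξ‖ ^ 2 + k ^ 2 : ℂ) ≠ 0 := by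
  have := symbol_ne_zero hk (s := 4 * Real.pi ^ 2 * ‖ξ‖ ^ 2) (by positivity)
  push_cast at this
  exact this

/-- Both sides are holomorphic in `Re k > 0` and agree for real `k`. For the left side, the integral
over `(y, t)` is treated as one integral of `e^(-k h)` with `h = |y| cosh t`. -/
theorem integral_cexp_inner_mul_green {k : ℂ} (hk : 0 < k.re) (ξ : Plane) :
    ∫ y : Plane, Complex.exp ((2 * Real.pi * inner ℝ y ξ : ℝ) * Complex.I) * green k y =
      resolventSymbol k ξ := by
  set g : Plane × ℝ → ℂ := fun p =>
    1 / (2 * Real.pi) * Complex.exp ((2 * Real.pi * inner ℝ p.1 ξ : ℝ) * Complex.I) with hg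
  set h : Plane × ℝ → ℝ := fun p => ‖p.1‖ * Real.cosh p.2 with hh
  have hgc : Continuous g := by fun_prop
  have hhc : Continuous h := by fun_prop
  have hgn : ∀ p, ‖g p‖ = 1 / (2 * Real.pi) := fun p => by
    rw [hg, norm_mul, Complex.norm_exp_ofReal_mul_I]
    simp [abs_of_pos Real.pi_pos]
  set μ : Measure (Plane × ℝ) := volume.prod (volume.restrict (Set.Ioi 0)) with hμ
  have hint : ∀ c : ℝ, 0 < c → Integrable (fun p => Real.exp (-(c * h p)) * ‖g p‖) μ :=
    fun c hc => by
      simp only [hgn]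
      exact (integrable_exp_neg_mul_norm_mul_cosh hc).mul_const _
  have key : ∀ k : ℂ, 0 < k.re →
      ∫ y : Plane, Complex.exp ((2 * Real.pi * inner ℝ y ξ : ℝ) * Complex.I) * green k y =
        ∫ p, Complex.exp (-(k * h p)) * g p ∂μ := fun k hk => by
    have hi : Integrable (fun p => Complex.exp (-(k * h p)) * g p) μ := by
      refine (hint k.re hk).mono' (Continuous.aestronglyMeasurable (by fun_prop))
        (Eventually.of_forall fun p => ?_)
      rw [norm_mul, Complex.norm_exp]
      simp
    rw [hμ, integral_prod _ (by simpa [hμ] using hi)]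
    congr 1
    ext y
    rw [green, radialGreen, ← mul_assoc, ← integral_const_mul]
    congr 1
    ext t
    simp only [hh, hg]
    rw [show -k * (‖y‖ : ℂ) * (Real.cosh t : ℂ) = -(k * ((‖y‖ * Real.cosh t : ℝ) : ℂ)) by
      push_cast; ring]
    ring
  rw [key k hk]
  refine eq_of_eq_ofReal (f := fun k => ∫ p, Complex.exp (-(k * h p)) * g p ∂μ)
    (g := fun k => resolventSymbol k ξ) (fun k hk => ?_) (fun k hk => ?_) (fun c hc => ?_) hk
  · exact differentiableAt_integral_cexp_neg_mul hgc.aestronglyMeasurable hhc.aemeasurable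
      (Eventually.of_forall fun p => mul_nonneg (norm_nonneg _) (Real.cosh_pos _).le) hint hk
  · exact (differentiableAt_const _).div (by fun_prop) (laplacian_symbol_ne_zero hk ξ)
  · rw [← key c (by simpa using hc), integral_cexp_inner_mul_green_ofReal hc]
    rfl

/-! ### The free resolvent as a Fourier multiplier -/

section FourierMultipliers

open FourierTransform TemperedDistribution
open scoped ENNReal ContDiff

/-- The symbol `(1 + |ξ|²) / (4π²|ξ|² + k²)` as a function of `s = 1 / (1 + |ξ|²)`. -/
def compactSymbol (k : ℂ) (s : ℝ) : ℂ := 1 / (4 * Real.pi ^ 2 + (k ^ 2 - 4 * Real.pi ^ 2) * s)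

theorem compactSymbol_denom_ne_zero {k : ℂ} (hk : 0 < k.re) {s : ℝ} (hs : s ∈ Set.Icc (0 : ℝ) 1) :
    (4 * Real.pi ^ 2 + (k ^ 2 - 4 * Real.pi ^ 2) * s : ℂ) ≠ 0 := by
  rcases hs.1.eq_or_lt with rfl | h0
  · simp [Real.pi_ne_zero]
  · have h := symbol_ne_zero hk (s := 4 * Real.pi ^ 2 * (1 - s) / s)
      (div_nonneg (mul_nonneg (by positivity) (by linarith [hs.2])) h0.le)
    have hs' : (s : ℂ) ≠ 0 := by exact_mod_cast h0.ne'
    intro h'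
    apply h
    push_cast
    field_simp
    linear_combination h'

theorem contDiffOn_compactSymbol {k : ℂ} (hk : 0 < k.re) :
    ContDiffOn ℝ ∞ (compactSymbol k) (Set.Icc 0 1) := by
  have h : ContDiff ℝ ∞ (fun s : ℝ => (s : ℂ)) := Complex.ofRealCLM.contDiff
  unfold compactSymbol
  simp only [one_div]
  exact (contDiff_const.add (contDiff_const.mul h)).contDiffOn.inv
    fun s hs => compactSymbol_denom_ne_zero hk hs

theorem exists_norm_compactSymbol_le {k : ℂ} (hk : 0 < k.re) :
    ∃ C, ∀ s ∈ Set.Icc (0 : ℝ) 1, ‖compactSymbol k s‖ ≤ C :=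
  isCompact_Icc.exists_bound_of_continuousOn (contDiffOn_compactSymbol hk).continuousOn

/-- The function `1 / (1 + |ξ|²)`. -/
def bessel (ξ : Plane) : ℝ := (1 + ‖ξ‖ ^ 2) ^ (-1 : ℝ)

theorem bessel_mem_Icc (ξ : Plane) : bessel ξ ∈ Set.Icc (0 : ℝ) 1 := by
  rw [bessel, Real.rpow_neg_one]
  have : 0 ≤ ‖ξ‖ ^ 2 := by positivity
  exact ⟨by positivity, inv_le_one_of_one_le₀ (by linarith)⟩

theorem hasTemperateGrowth_bessel : bessel.HasTemperateGrowth :=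
  Function.hasTemperateGrowth_one_add_norm_sq_rpow Plane (-1)

/-- A smooth function on the compact interval `[0, 1]` has bounded derivatives of every order, so
its composite with `bessel` has temperate growth. This avoids estimating derivatives of the complex
quotient directly. -/
theorem hasTemperateGrowth_compactSymbol_comp_bessel {k : ℂ} (hk : 0 < k.re) :
    (compactSymbol k ∘ bessel).HasTemperateGrowth := by
  have hu : UniqueDiffOn ℝ (Set.Icc (0 : ℝ) 1) := uniqueDiffOn_Icc_zero_one
  refine Function.HasTemperateGrowth.comp' (Set.range_subset_iff.2 bessel_mem_Icc) hu
    (contDiffOn_compactSymbol hk) (fun N => ?_) hasTemperateGrowth_bessel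
  have hb : ∀ n : ℕ, ∃ C, ∀ s ∈ Set.Icc (0 : ℝ) 1,
      ‖iteratedFDerivWithin ℝ n (compactSymbol k) (Set.Icc 0 1) s‖ ≤ C := fun n =>
    isCompact_Icc.exists_bound_of_continuousOn
      ((contDiffOn_compactSymbol hk).continuousOn_iteratedFDerivWithin (by exact_mod_cast le_top) hu)
  choose C hC using hb
  refine ⟨0, ∑ n ∈ Finset.range (N + 1), |C n|, Finset.sum_nonneg fun _ _ => abs_nonneg _,
    fun n hn s hs => ?_⟩
  rw [pow_zero, mul_one]
  exact ((hC n s hs).trans (le_abs_self _)).trans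
    (Finset.single_le_sum (f := fun n => |C n|) (fun _ _ => abs_nonneg _)
      (Finset.mem_range.2 (by omega)))

theorem resolventSymbol_eq {k : ℂ} (hk : 0 < k.re) (ξ : Plane) :
    resolventSymbol k ξ = bessel ξ * compactSymbol k (bessel ξ) := by
  have h1 := laplacian_symbol_ne_zero hk ξ
  have h2 := compactSymbol_denom_ne_zero hk (bessel_mem_Icc ξ)
  have h3 : (1 + ‖ξ‖ ^ 2 : ℝ) ≠ 0 := by positivity
  have h4 : (bessel ξ : ℂ) * (1 + ‖ξ‖ ^ 2) = 1 := by
    rw [bessel, Real.rpow_neg_one]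
    exact_mod_cast inv_mul_cancel₀ h3
  rw [resolventSymbol, compactSymbol, mul_one_div, div_eq_div_iff h1 h2]
  linear_combination (-4 * Real.pi ^ 2 : ℂ) * h4

theorem hasTemperateGrowth_resolventSymbol {k : ℂ} (hk : 0 < k.re) :
    (resolventSymbol k).HasTemperateGrowth := by
  have h1 : (fun ξ => (bessel ξ : ℂ)).HasTemperateGrowth :=
    Function.HasTemperateGrowth.comp (g := Complex.ofReal)
      Function.Complex.hasTemperateGrowth_ofReal hasTemperateGrowth_bessel
  have h2 := h1.mul (hasTemperateGrowth_compactSymbol_comp_bessel hk)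
  rw [show resolventSymbol k = _ from funext (resolventSymbol_eq hk)]
  exact h2

theorem exists_norm_resolventSymbol_le {k : ℂ} (hk : 0 < k.re) :
    ∃ C, ∀ ξ, ‖resolventSymbol k ξ‖ ≤ C := by
  obtain ⟨C, hC⟩ := exists_norm_compactSymbol_le hk
  refine ⟨C, fun ξ => ?_⟩
  obtain ⟨h0, h1⟩ := bessel_mem_Icc ξ
  rw [resolventSymbol_eq hk, norm_mul, Complex.norm_real, Real.norm_of_nonneg h0]
  have := hC _ (bessel_mem_Icc ξ)
  nlinarith [norm_nonneg (compactSymbol k (bessel ξ))]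

theorem memLp_top_resolventSymbol {k : ℂ} (hk : 0 < k.re) :
    MemLp (resolventSymbol k) ∞ (volume : Measure Plane) := by
  obtain ⟨C, hC⟩ := exists_norm_resolventSymbol_le hk
  exact memLp_top_of_bound
    (hasTemperateGrowth_resolventSymbol hk).1.continuous.aestronglyMeasurable C
    (Eventually.of_forall hC)

/-- Multiplication by an essentially bounded function on `L²`. -/
def multiplication {g : Plane → ℂ} (hg : MemLp g ∞ (volume : Measure Plane)) : L2 →L[ℂ] L2 :=
  LinearMap.mkContinuous
    { toFun := fun f => (hg.toLp g • f : L2)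
      map_add' := fun _ _ => Lp.add_smul _ _ _
      map_smul' := fun c f => (Lp.smul_comm c (hg.toLp g) f).symm }
    ‖hg.toLp g‖ fun _ => Lp.norm_smul_le _ _

theorem multiplication_apply {g : Plane → ℂ} (hg : MemLp g ∞ (volume : Measure Plane)) (f : L2) :
    multiplication hg f = (hg.toLp g • f : L2) := rfl

theorem coeFn_multiplication {g : Plane → ℂ} (hg : MemLp g ∞ (volume : Measure Plane)) (f : L2) :
    multiplication hg f =ᵐ[volume] fun ξ => g ξ * f ξ := by
  rw [multiplication_apply]
  filter_upwards [Lp.coeFn_lpSMul (r := 2) (hg.toLp g) f, hg.coeFn_toLp] with ξ h1 h2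
  rw [h1, Pi.smul_apply', h2, smul_eq_mul]

/-- The resolvent `(-Δ + k²)⁻¹` of the free Laplacian on `L²(ℝ²)`, as a Fourier multiplier. -/
def freeResolvent {k : ℂ} (hk : 0 < k.re) : L2 →L[ℂ] L2 :=
  fourierInvCLM ℂ L2 ∘L multiplication (memLp_top_resolventSymbol hk) ∘L fourierCLM ℂ L2

theorem freeResolvent_apply {k : ℂ} (hk : 0 < k.re) (u : L2) :
    freeResolvent hk u = 𝓕⁻ (multiplication (memLp_top_resolventSymbol hk) (𝓕 u)) := rfl

theorem toDist_apply (f : L2) : toDist f = Lp.toTemperedDistribution f := rfl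

theorem toDist_freeResolvent {k : ℂ} (hk : 0 < k.re) (u : L2) :
    toDist (freeResolvent hk u) = fourierMultiplierCLM ℂ (resolventSymbol k) (toDist u) := by
  rw [freeResolvent_apply, fourierMultiplierCLM_apply, toDist_apply, toDist_apply,
    ← Lp.fourierInv_toTemperedDistribution_eq, Lp.fourier_toTemperedDistribution_eq,
    multiplication_apply,
    Lp.toTemperedDistribution_smul_eq (hasTemperateGrowth_resolventSymbol hk)]

theorem hasTemperateGrowth_laplacianSymbol (k : ℂ) :
    (fun ξ : Plane => (4 * Real.pi ^ 2 * ‖ξ‖ ^ 2 + k ^ 2 : ℂ)).HasTemperateGrowth := by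
  have h : (fun ξ : Plane => (4 * Real.pi ^ 2 : ℂ) * ((‖ξ‖ ^ 2 : ℝ) : ℂ) +
      k ^ 2).HasTemperateGrowth := by fun_prop
  simpa using h

theorem neg_laplacian_add_eq_fourierMultiplierCLM (k : ℂ) (f : 𝓢'(Plane, ℂ)) :
    -Δ f + k ^ 2 • f =
      fourierMultiplierCLM ℂ (fun ξ => (4 * Real.pi ^ 2 * ‖ξ‖ ^ 2 + k ^ 2 : ℂ)) f := by
  have h : (fun ξ : Plane => (4 * Real.pi ^ 2 * ‖ξ‖ ^ 2 + k ^ 2 : ℂ)) =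
      (4 * Real.pi ^ 2 : ℂ) • (fun ξ : Plane => Complex.ofReal (‖ξ‖ ^ 2)) + fun _ => k ^ 2 := by
    ext ξ
    simp
  have h1 : (fun ξ : Plane => Complex.ofReal (‖ξ‖ ^ 2)).HasTemperateGrowth := by fun_prop
  have h2 : ((4 * Real.pi ^ 2 : ℂ) •
      (fun ξ : Plane => Complex.ofReal (‖ξ‖ ^ 2))).HasTemperateGrowth := by
    have : (fun ξ : Plane => (4 * Real.pi ^ 2 : ℂ) * Complex.ofReal (‖ξ‖ ^ 2)).HasTemperateGrowth :=
      by fun_prop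
    exact this
  have h3 : (fun _ : Plane => k ^ 2).HasTemperateGrowth := by fun_prop
  rw [h, fourierMultiplierCLM_apply, smulLeftCLM_add h2 h3, smulLeftCLM_smul h1,
    laplacian_eq_fourierMultiplierCLM, fourierMultiplierCLM_apply]
  simp only [add_apply, smul_apply, smulLeftCLM_const]
  rw [FourierTransform.fourierInv_add, FourierTransform.fourierInv_smul,
    FourierTransform.fourierInv_smul, FourierTransform.fourierInv_fourier_eq]
  congr 1
  rw [← Complex.coe_smul, ← neg_smul]
  congr 1
  push_cast
  ring

theorem neg_laplacian_freeResolvent {k : ℂ} (hk : 0 < k.re) (u : L2) :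
    -Δ (toDist (freeResolvent hk u)) = toDist (u - k ^ 2 • freeResolvent hk u) := by
  rw [map_sub, map_smul, eq_sub_iff_add_eq, neg_laplacian_add_eq_fourierMultiplierCLM,
    toDist_freeResolvent, fourierMultiplierCLM_fourierMultiplierCLM_apply
      (hasTemperateGrowth_resolventSymbol hk) (hasTemperateGrowth_laplacianSymbol k)]
  have : resolventSymbol k * (fun ξ : Plane => (4 * Real.pi ^ 2 * ‖ξ‖ ^ 2 + k ^ 2 : ℂ)) =
      fun _ => 1 := by
    ext ξ
    rw [Pi.mul_apply, resolventSymbol, one_div, inv_mul_cancel₀ (laplacian_symbol_ne_zero hk ξ)]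
  rw [this, fourierMultiplierCLM_const]
  simp

theorem freeResolvent_of_neg_laplacian {k : ℂ} (hk : 0 < k.re) {f g : L2}
    (h : toDist g = -Δ (toDist f)) : freeResolvent hk (g + k ^ 2 • f) = f := by
  apply toDist_injective
  rw [toDist_freeResolvent, map_add, map_smul, h, neg_laplacian_add_eq_fourierMultiplierCLM,
    fourierMultiplierCLM_fourierMultiplierCLM_apply (hasTemperateGrowth_laplacianSymbol k)
      (hasTemperateGrowth_resolventSymbol hk)]
  have : (fun ξ : Plane => (4 * Real.pi ^ 2 * ‖ξ‖ ^ 2 + k ^ 2 : ℂ)) * resolventSymbol k =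
      fun _ => 1 := by
    ext ξ
    rw [Pi.mul_apply, resolventSymbol, one_div, mul_inv_cancel₀ (laplacian_symbol_ne_zero hk ξ)]
  rw [this, fourierMultiplierCLM_const]
  simp

theorem freeResolvent_injective {k : ℂ} (hk : 0 < k.re) :
    Function.Injective (freeResolvent hk) := by
  rw [injective_iff_map_eq_zero]
  intro u hu
  have h := neg_laplacian_freeResolvent hk u
  rw [hu] at h
  apply toDist_injective
  rw [map_zero, ← laplacianCLM_apply, map_zero] at h
  simpa using h.symm

/-- Multiplying the resolvent symbol by `1 + |ξ|²` leaves the bounded symbol `compactSymbol k ∘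
bessel`: the resolvent gains two derivatives. -/
theorem memSobolev_freeResolvent {k : ℂ} (hk : 0 < k.re) (u : L2) :
    MemSobolev 2 2 (toDist (freeResolvent hk u)) := by
  have h0 : MemSobolev 0 2 (toDist u) := memSobolev_zero_iff.2 ⟨u, rfl⟩
  have hg := hasTemperateGrowth_compactSymbol_comp_bessel hk
  have hb : ∃ C, ∀ ξ, ‖(compactSymbol k ∘ bessel) ξ‖ ≤ C := by
    obtain ⟨C, hC⟩ := exists_norm_compactSymbol_le hk
    exact ⟨C, fun ξ => hC _ (bessel_mem_Icc ξ)⟩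
  obtain ⟨v, hv⟩ := memSobolev_zero_iff.1 (h0.fourierMultiplierCLM_of_bounded hg hb)
  refine ⟨v, ?_⟩
  rw [← hv, toDist_freeResolvent, besselPotential, fourierMultiplierCLM_fourierMultiplierCLM_apply
    (hasTemperateGrowth_resolventSymbol hk) (by fun_prop)]
  refine congrArg (fun g => fourierMultiplierCLM ℂ g (toDist u)) (funext fun ξ => ?_)
  have h3 : (1 + ‖ξ‖ ^ 2 : ℝ) ≠ 0 := by positivity
  rw [Pi.mul_apply, resolventSymbol_eq hk, mul_right_comm, ← Complex.ofReal_mul, bessel,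
    Real.rpow_neg_one]
  norm_num
  rw [inv_mul_cancel₀ (by exact_mod_cast h3), one_mul]
  simp [bessel, Real.rpow_neg_one]

theorem freeResolvent_mem_W22 {k : ℂ} (hk : 0 < k.re) (u : L2) : freeResolvent hk u ∈ W22 := by
  have h := memSobolev_freeResolvent hk u
  refine ⟨fun i => ?_, fun i j => ?_⟩
  · obtain ⟨g, hg⟩ := memSobolev_zero_iff.1 ((h.lineDerivOp (m := stdVec i)).mono
      (by norm_num : (0 : ℝ) ≤ 2 - 1))
    exact ⟨g, hg.symm⟩
  · obtain ⟨g, hg⟩ := memSobolev_zero_iff.1 (((h.lineDerivOp (m := stdVec j)).lineDerivOp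
      (m := stdVec i)).mono (by norm_num : (0 : ℝ) ≤ 2 - 1 - 1))
    exact ⟨g, hg.symm⟩

theorem mem_W22_iff {k : ℂ} (hk : 0 < k.re) {f : L2} :
    f ∈ W22 ↔ ∃ u, freeResolvent hk u = f := by
  constructor
  · intro hf
    obtain ⟨g, hg⟩ := exists_neg_laplacian hf
    exact ⟨_, freeResolvent_of_neg_laplacian hk hg⟩
  · rintro ⟨u, rfl⟩
    exact freeResolvent_mem_W22 hk u

theorem re_one_pos : 0 < (1 : ℂ).re := by simp

/-- Plancherel, and the symbol is real at `k = 1`. -/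
theorem inner_freeResolvent_one (u v : L2) :
    inner ℂ (freeResolvent re_one_pos u) v = inner ℂ u (freeResolvent re_one_pos v) := by
  set M := multiplication (memLp_top_resolventSymbol re_one_pos) with hM
  have h1 : ∀ a b : L2, inner ℂ (M a) b = inner ℂ a (M b) := fun a b => by
    rw [L2.inner_def, L2.inner_def]
    refine integral_congr_ae ?_
    filter_upwards [coeFn_multiplication (memLp_top_resolventSymbol re_one_pos) a,
      coeFn_multiplication (memLp_top_resolventSymbol re_one_pos) b] with ξ ha hb
    rw [hM, ha, hb]
    have : starRingEnd ℂ (resolventSymbol 1 ξ) = resolventSymbol 1 ξ := by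
      simp [resolventSymbol, Complex.conj_ofNat]
    simp only [RCLike.inner_apply, map_mul, this]
    ring
  have h2 : ∀ a b : L2, inner ℂ (𝓕⁻ a) b = inner ℂ a (𝓕 b) := fun a b => by
    rw [← Lp.inner_fourier_eq, fourier_fourierInv_eq]
  have h3 : ∀ a b : L2, inner ℂ a (𝓕⁻ b) = inner ℂ (𝓕 a) b := fun a b => by
    rw [← Lp.inner_fourier_eq, fourier_fourierInv_eq]
  rw [freeResolvent_apply, freeResolvent_apply, h2, h3, h1]

/-! ### The Green function as kernel of the free resolvent -/

/-- The Green function with its singularity at `y`, as an element of `L²(ℝ²)`. -/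
def greenAt {k : ℂ} (hk : 0 < k.re) (y : Plane) : L2 :=
  ((memLp_green hk).comp_measurePreserving (measurePreserving_sub_right volume y)).toLp
    (green k ∘ fun w => w - y)

theorem coeFn_greenAt {k : ℂ} (hk : 0 < k.re) (y : Plane) :
    greenAt hk y =ᵐ[volume] fun w => green k (w - y) :=
  MemLp.coeFn_toLp _

theorem continuous_greenAt {k : ℂ} (hk : 0 < k.re) : Continuous (greenAt hk) := by
  let g : Plane → C(Plane, Plane) := fun y => ⟨fun w => w - y, by fun_prop⟩
  have hg : Continuous g := by
    refine ContinuousMap.continuous_of_continuous_uncurry g ?_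
    simp only [g, Function.uncurry_def, ContinuousMap.coe_mk]
    fun_prop
  have h := Continuous.compMeasurePreservingLp (p := 2) (E := ℂ)
    (f := fun _ : Plane => (memLp_green hk).toLp (green k)) continuous_const hg
    (fun y => measurePreserving_sub_right (volume : Measure Plane) y) (by norm_num)
  exact h

theorem inner_greenAt {k : ℂ} (hk : 0 < k.re) (y : Plane) (u : L2) :
    inner ℂ (greenAt hk y) u = ∫ w, green (starRingEnd ℂ k) (w - y) * u w := by
  rw [L2.inner_def]
  refine integral_congr_ae ?_
  filter_upwards [coeFn_greenAt hk y] with w hw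
  rw [hw, RCLike.inner_apply, conj_green, mul_comm]

/-- Insert Fourier inversion for `φ` and exchange the integrals; translating by `y` turns the inner
one into a character times the transform of `green k`. -/
theorem integral_green_sub_mul_schwartz {k : ℂ} (hk : 0 < k.re) (y : Plane) (φ : 𝓢(Plane, ℂ)) :
    ∫ w, green k (w - y) * φ w =
      SchwartzMap.fourierMultiplierCLM ℂ (resolventSymbol k) φ y := by
  set ψ : 𝓢(Plane, ℂ) := 𝓕 φ with hψ
  have hφ : ∀ w, φ w = ∫ v, Complex.exp ((2 * Real.pi * inner ℝ v w : ℝ) * Complex.I) * ψ v :=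
    fun w => by
      have h1 : φ = 𝓕⁻ ψ := (fourierInv_fourier_eq φ).symm
      rw [h1, SchwartzMap.fourierInv_coe, Real.fourierInv_eq']
      simp only [smul_eq_mul, hψ]
  rw [SchwartzMap.fourierMultiplierCLM_apply, SchwartzMap.fourierInv_coe, Real.fourierInv_eq']
  set F : Plane → Plane → ℂ := fun w v => green k (w - y) *
    (Complex.exp ((2 * Real.pi * inner ℝ v w : ℝ) * Complex.I) * ψ v) with hF
  have hint : Integrable (Function.uncurry F) (volume.prod volume) := by
    have h1 : Integrable (fun p : Plane × Plane => green k (p.1 - y) * ψ p.2)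
        (volume.prod volume) :=
      ((integrable_green hk).comp_sub_right y).mul_prod ψ.integrable
    have h2 := h1.bdd_mul (c := 1) (f := fun p : Plane × Plane =>
      Complex.exp ((2 * Real.pi * inner ℝ p.2 p.1 : ℝ) * Complex.I))
      (Continuous.aestronglyMeasurable (by fun_prop))
      (Eventually.of_forall fun p => by rw [Complex.norm_exp_ofReal_mul_I])
    refine h2.congr (Eventually.of_forall fun p => ?_)
    simp only [hF, Function.uncurry_def]
    ring
  have h1 : ∫ w, green k (w - y) * φ w = ∫ w, ∫ v, F w v := by
    congr 1
    ext w
    rw [hφ w, ← integral_const_mul]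
  rw [h1, integral_integral_swap hint]
  congr 1
  ext v
  rw [SchwartzMap.smulLeftCLM_apply_apply (hasTemperateGrowth_resolventSymbol hk),
    ← integral_cexp_inner_mul_green hk]
  have h2 : ∀ w, F w v = ψ v * (Complex.exp ((2 * Real.pi * inner ℝ v y : ℝ) * Complex.I) *
      (Complex.exp ((2 * Real.pi * inner ℝ (w - y) v : ℝ) * Complex.I) * green k (w - y))) :=
    fun w => by
      have h3 : Complex.exp ((2 * Real.pi * inner ℝ v w : ℝ) * Complex.I) =
          Complex.exp ((2 * Real.pi * inner ℝ v y : ℝ) * Complex.I) *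
          Complex.exp ((2 * Real.pi * inner ℝ (w - y) v : ℝ) * Complex.I) := by
        rw [← Complex.exp_add, ← add_mul, ← Complex.ofReal_add]
        congr 3
        rw [inner_sub_left, real_inner_comm v w, real_inner_comm v y]
        ring
      simp only [hF]
      rw [h3]
      ring
  simp only [h2]
  rw [integral_const_mul, integral_const_mul, integral_sub_right_eq_self
    (fun w => Complex.exp ((2 * Real.pi * inner ℝ w v : ℝ) * Complex.I) * green k w) y]
  simp only [smul_eq_mul]
  ring

theorem freeResolvent_toLp {k : ℂ} (hk : 0 < k.re) (φ : 𝓢(Plane, ℂ)) :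
    freeResolvent hk (φ.toLp 2) =
      (SchwartzMap.fourierMultiplierCLM ℂ (resolventSymbol k) φ).toLp 2 := by
  apply toDist_injective
  rw [toDist_freeResolvent, toDist_apply, toDist_apply, Lp.toTemperedDistribution_toLp_eq,
    Lp.toTemperedDistribution_toLp_eq, fourierMultiplierCLM_toTemperedDistributionCLM_eq
      (hasTemperateGrowth_resolventSymbol hk)]

/-- The continuous representative of `(-Δ + k²)⁻¹ u`. -/
theorem coeFn_freeResolvent {k l : ℂ} (hk : 0 < k.re) (hl : 0 < l.re) (h : l = starRingEnd ℂ k)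
    (u : L2) : freeResolvent hl u =ᵐ[volume] fun y => inner ℂ (greenAt hk y) u := by
  -- Approximate `u` by Schwartz functions. The left side converges almost everywhere along a
  -- subsequence, the right side at every `y`. The relation `l = conj k` compensates for the
  -- conjugation in the first argument of `inner`.
  obtain ⟨φ, hφ⟩ := mem_closure_iff_seq_limit.1
    ((SchwartzMap.denseRange_toLpCLM (E := Plane) (F := ℂ) (p := 2) (μ := volume)
      ENNReal.ofNat_ne_top) u)
  obtain ⟨hmem, hlim⟩ := hφ
  have h1 : Tendsto (fun n => freeResolvent hl (φ n)) atTop (𝓝 (freeResolvent hl u)) :=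
    ((freeResolvent hl).continuous.tendsto u).comp hlim
  obtain ⟨ns, hns, hae⟩ := (tendstoInMeasure_of_tendsto_Lp h1).exists_seq_tendsto_ae
  have h2 : ∀ n, freeResolvent hl (φ n) =ᵐ[volume] fun y => inner ℂ (greenAt hk y) (φ n) :=
    fun n => by
      obtain ⟨f, hf⟩ := hmem n
      have hf' : φ n = f.toLp 2 := hf.symm
      rw [hf', freeResolvent_toLp]
      filter_upwards [SchwartzMap.coeFn_toLp
        (SchwartzMap.fourierMultiplierCLM ℂ (resolventSymbol l) f) 2 (volume : Measure Plane)]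
        with y hy
      rw [hy, inner_greenAt, ← integral_green_sub_mul_schwartz hl, h]
      refine integral_congr_ae ?_
      filter_upwards [SchwartzMap.coeFn_toLp f 2 (volume : Measure Plane)] with w hw
      rw [hw]
  filter_upwards [hae, ae_all_iff.2 h2] with y hy hy2
  refine tendsto_nhds_unique hy ?_
  simp only [hy2]
  exact (tendsto_const_nhds.inner hlim).comp hns.tendsto_atTop

theorem continuous_inner_greenAt {k : ℂ} (hk : 0 < k.re) (u : L2) :
    Continuous fun y => inner ℂ (greenAt hk y) u :=
  (continuous_greenAt hk).inner continuous_const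

theorem eq_inner_greenAt {k l : ℂ} (hk : 0 < k.re) (hl : 0 < l.re) (h : l = starRingEnd ℂ k)
    {u : L2} {v : Plane → ℂ} (hv : Continuous v) (hvu : freeResolvent hl u =ᵐ[volume] v)
    (y : Plane) : v y = inner ℂ (greenAt hk y) u :=
  congrFun (Measure.eq_of_ae_eq (hvu.symm.trans (coeFn_freeResolvent hk hl h u)) hv
    (continuous_inner_greenAt hk u)) y

end FourierMultipliers

/-! ### Logarithmic expansions at the points -/

/-- `u` is continuous off the points `x_j`, near which `u(y) = ξ_j ln|y - x_j| + b_j + o(1)`. -/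
def HasLogExpansion {m : ℕ} (x : Fin m → Plane) (u : Plane → ℂ) (ξ b : Fin m → ℂ) : Prop :=
  ContinuousOn u (Set.range x)ᶜ ∧ ∀ j,
    Tendsto (fun y => u y / (Real.log ‖y - x j‖ : ℂ)) (𝓝[≠] x j) (𝓝 (ξ j)) ∧
    Tendsto (fun y => u y - (Real.log ‖y - x j‖ : ℂ) * ξ j) (𝓝[≠] x j) (𝓝 (b j))

theorem compl_range_mem_nhdsNE {m : ℕ} (x : Fin m → Plane) (j : Fin m) :
    (Set.range x)ᶜ ∈ 𝓝[≠] x j :=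
  nhdsNE_le_cofinite _ (Set.finite_range x).compl_mem_cofinite

/-- Functions continuous on the open complement of the points and equal almost everywhere coincide
there, so the coefficients belong to the `L²` class. -/
theorem HasLogExpansion.unique {m : ℕ} {x : Fin m → Plane} {u u' : Plane → ℂ}
    {ξ b ξ' b' : Fin m → ℂ} (h : HasLogExpansion x u ξ b) (h' : HasLogExpansion x u' ξ' b')
    (huu' : u =ᵐ[volume] u') : ξ = ξ' ∧ b = b' := by
  have heq : Set.EqOn u u' (Set.range x)ᶜ :=
    Measure.eqOn_open_of_ae_eq (ae_restrict_of_ae huu') (Set.finite_range x).isClosed.isOpen_compl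
      h.1 h'.1
  have hev : ∀ j, u =ᶠ[𝓝[≠] x j] u' := fun j => by
    filter_upwards [compl_range_mem_nhdsNE x j] with y hy using heq hy
  have hξ : ξ = ξ' := funext fun j => tendsto_nhds_unique (h.2 j).1 <| (h'.2 j).1.congr' <| by
    filter_upwards [hev j] with y hy
    rw [hy]
  refine ⟨hξ, funext fun j => tendsto_nhds_unique (h.2 j).2 <| (h'.2 j).2.congr' ?_⟩
  filter_upwards [hev j] with y hy
  rw [hy, hξ]

theorem tendsto_log_norm_sub (p : Plane) :
    Tendsto (fun y => Real.log ‖y - p‖) (𝓝[≠] p) atBot :=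
  Real.tendsto_log_nhdsNE_zero.comp ((tendsto_norm_sub_self_nhdsNE p).mono_right
    (nhdsWithin_mono _ fun _ hr => ne_of_gt hr))

theorem tendsto_div_log {p : Plane} {u : Plane → ℂ} {ξ b : ℂ}
    (h : Tendsto (fun y => u y - (Real.log ‖y - p‖ : ℂ) * ξ) (𝓝[≠] p) (𝓝 b)) :
    Tendsto (fun y => u y / (Real.log ‖y - p‖ : ℂ)) (𝓝[≠] p) (𝓝 ξ) := by
  have hl := tendsto_log_norm_sub p
  have h1 : Tendsto (fun y => ((Real.log ‖y - p‖)⁻¹ : ℂ)) (𝓝[≠] p) (𝓝 0) := by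
    have := (Complex.continuous_ofReal.tendsto 0).comp (tendsto_inv_atBot_zero.comp hl)
    simpa [Function.comp_def] using this
  have h2 := (h.mul h1).add_const ξ
  rw [mul_zero, zero_add] at h2
  refine h2.congr' ?_
  filter_upwards [hl.eventually (eventually_lt_atBot 0)] with y hy
  have : (Real.log ‖y - p‖ : ℂ) ≠ 0 := by exact_mod_cast hy.ne
  field_simp
  ring

/-- The finite parts at `x_j` of the Green functions with singularities at `x_l`. -/
def greenMatrix (k : ℂ) {m : ℕ} (x : Fin m → Plane) : Matrix (Fin m) (Fin m) ℂ :=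
  Matrix.of fun j l =>
    if j = l then 1 / (2 * Real.pi) * (Complex.digamma 1 - Complex.log (k / 2))
    else green k (x j - x l)

/-- Near `x_j` only the `j`-th Green function is singular; the others are continuous there because
the points are distinct. -/
theorem hasLogExpansion_add_sum_green {k : ℂ} (hk : 0 < k.re) {m : ℕ} {x : Fin m → Plane}
    (hx : Function.Injective x) {c : Plane → ℂ} (hc : Continuous c) (a : Fin m → ℂ) :
    HasLogExpansion x (fun y => c y + ∑ l, a l * green k (y - x l))
      (fun j => -(a j / (2 * Real.pi))) (fun j => c (x j) + (greenMatrix k x).mulVec a j) := by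
  have hcont : ∀ l, ContinuousOn (fun y => green k (y - x l)) {x l}ᶜ := fun l =>
    (continuousOn_green hk).comp (by fun_prop) fun y hy => by simpa [sub_eq_zero] using hy
  have hb : ∀ j, Tendsto (fun y => (c y + ∑ l, a l * green k (y - x l)) -
      (Real.log ‖y - x j‖ : ℂ) * -(a j / (2 * Real.pi))) (𝓝[≠] x j)
      (𝓝 (c (x j) + (greenMatrix k x).mulVec a j)) := fun j => by
    have h1 : ∀ l, Tendsto (fun y => a l * green k (y - x l) +
        if j = l then (Real.log ‖y - x j‖ : ℂ) * (a j / (2 * Real.pi)) else 0) (𝓝[≠] x j)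
        (𝓝 (greenMatrix k x j l * a l)) := fun l => by
      by_cases hjl : j = l
      · subst hjl
        have h2 := ((tendsto_radialGreen_add_log hk).comp
          (tendsto_norm_sub_self_nhdsNE (x j))).mul_const (a j)
        simp only [greenMatrix, Matrix.of_apply, if_true]
        refine h2.congr fun y => ?_
        simp only [Function.comp_apply, green]
        ring
      · simp only [greenMatrix, Matrix.of_apply, if_neg hjl, add_zero]
        have h2 : ContinuousAt (fun y => green k (y - x l)) (x j) :=
          (hcont l).continuousAt (isOpen_compl_singleton.mem_nhds
            (by simpa using fun h => hjl (hx h)))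
        have h3 := (h2.tendsto.const_mul (a l)).mono_left
          (nhdsWithin_le_nhds (s := {x j}ᶜ))
        rwa [mul_comm (a l)] at h3
    have h4 := ((hc.tendsto (x j)).mono_left (nhdsWithin_le_nhds (s := {x j}ᶜ))).add
      (tendsto_finsetSum Finset.univ fun l _ => h1 l)
    refine h4.congr fun y => ?_
    rw [Finset.sum_add_distrib, Finset.sum_ite_eq]
    simp only [Finset.mem_univ, if_true]
    ring
  refine ⟨?_, fun j => ⟨tendsto_div_log (hb j), hb j⟩⟩
  refine hc.continuousOn.add (continuousOn_finsetSum _ fun l _ => continuousOn_const.mul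
    ((hcont l).mono ?_))
  exact Set.compl_subset_compl.2 (Set.singleton_subset_iff.2 (Set.mem_range_self l))

/-- The diagonal entry is a limit of quantities fixed by conjugation, so its reality needs no
separate fact about `ψ(1)`. Off the diagonal, `green 1` is real and even. -/
theorem conj_greenMatrix_one {m : ℕ} (x : Fin m → Plane) (j l : Fin m) :
    starRingEnd ℂ (greenMatrix 1 x j l) = greenMatrix 1 x l j := by
  by_cases hjl : j = l
  · subst hjl
    simp only [greenMatrix, Matrix.of_apply, if_true]
    have h := tendsto_radialGreen_add_log re_one_pos
    refine tendsto_nhds_unique ((Complex.continuous_conj.tendsto _).comp h) (h.congr fun r => ?_)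
    simp only [Function.comp_apply, map_add, map_mul, conj_radialGreen, map_one, map_div₀,
      Complex.conj_ofReal, map_ofNat]
  · simp only [greenMatrix, Matrix.of_apply, if_neg hjl, if_neg (Ne.symm hjl)]
    rw [conj_green, map_one, ← green_neg, neg_sub]

/-! ### Green sums and the parametrization of the maximal domain -/

/-- The superposition `∑ a_j G_k(· - x_j)` of Green functions. -/
def greenSum {k : ℂ} (hk : 0 < k.re) {m : ℕ} (x : Fin m → Plane) :
    EuclideanSpace ℂ (Fin m) →ₗ[ℂ] L2 where
  toFun a := ∑ j, a j • greenAt hk (x j)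
  map_add' a b := by simp [add_smul, Finset.sum_add_distrib]
  map_smul' c a := by simp [mul_smul, Finset.smul_sum]

theorem greenSum_apply {k : ℂ} (hk : 0 < k.re) {m : ℕ} (x : Fin m → Plane)
    (a : EuclideanSpace ℂ (Fin m)) : greenSum hk x a = ∑ j, a j • greenAt hk (x j) := rfl

theorem coeFn_greenSum {k : ℂ} (hk : 0 < k.re) {m : ℕ} (x : Fin m → Plane)
    (a : EuclideanSpace ℂ (Fin m)) :
    greenSum hk x a =ᵐ[volume] fun y => ∑ j, a j * green k (y - x j) := by
  rw [greenSum_apply]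
  filter_upwards [Lp.coeFn_finsetSum Finset.univ fun j => a j • greenAt hk (x j),
    ae_all_iff.2 fun j => Lp.coeFn_smul (a j) (greenAt hk (x j)),
    ae_all_iff.2 fun j => coeFn_greenAt hk (x j)] with y h1 h2 h3
  rw [h1, Finset.sum_apply]
  exact Finset.sum_congr rfl fun j _ => by rw [h2 j, Pi.smul_apply, h3 j, smul_eq_mul]

theorem inner_greenSum {k : ℂ} (hk : 0 < k.re) {m : ℕ} (x : Fin m → Plane)
    (a : EuclideanSpace ℂ (Fin m)) (u : L2) :
    inner ℂ (greenSum hk x a) u =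
      ∑ j, inner ℂ (greenAt hk (x j)) u * starRingEnd ℂ (a j) := by
  rw [greenSum_apply, sum_inner]
  exact Finset.sum_congr rfl fun j _ => by rw [inner_smul_left, mul_comm]

/-- The resolvent `(-Δ + 1)⁻¹`. -/
abbrev freeInv : L2 →L[ℂ] L2 := freeResolvent re_one_pos

/-- The linear parametrization of the domain of the maximal operator. -/
def maxParam {m : ℕ} (x : Fin m → Plane) : (L2 × EuclideanSpace ℂ (Fin m)) →ₗ[ℂ] L2 :=
  LinearMap.coprod (freeInv : L2 →ₗ[ℂ] L2) (greenSum re_one_pos x)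

theorem maxParam_apply {m : ℕ} (x : Fin m → Plane) (v : L2) (a : EuclideanSpace ℂ (Fin m)) :
    maxParam x (v, a) = freeInv v + greenSum re_one_pos x a := rfl

theorem coeFn_maxParam {m : ℕ} (x : Fin m → Plane) (v : L2) (a : EuclideanSpace ℂ (Fin m)) :
    maxParam x (v, a) =ᵐ[volume] fun y =>
      inner ℂ (greenAt re_one_pos y) v + ∑ l, a l * green 1 (y - x l) := by
  rw [maxParam_apply]
  filter_upwards [Lp.coeFn_add (freeInv v) (greenSum re_one_pos x a),
    coeFn_freeResolvent re_one_pos re_one_pos (by simp) v, coeFn_greenSum re_one_pos x a]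
    with y h1 h2 h3
  rw [h1, Pi.add_apply, h2, h3]

/-- The logarithmic coefficients recover `a`; injectivity of the free resolvent then recovers `v`.
-/
theorem maxParam_injective {m : ℕ} {x : Fin m → Plane} (hx : Function.Injective x) :
    Function.Injective (maxParam x) := by
  rw [injective_iff_map_eq_zero]
  rintro ⟨v, a⟩ h
  have h1 := hasLogExpansion_add_sum_green re_one_pos hx
    (continuous_inner_greenAt re_one_pos v) a
  have h2 := hasLogExpansion_add_sum_green re_one_pos hx (c := fun _ => 0) continuous_const
    (fun _ => 0)
  have h3 := (h1.unique h2 ?_).1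
  · have ha : a = 0 := by
      ext j
      have := congrFun h3 j
      simpa [Real.pi_ne_zero] using this
    rw [ha, maxParam_apply, map_zero, add_zero] at h
    rw [ha, freeResolvent_injective re_one_pos (h.trans (map_zero _).symm)]
    rfl
  · refine (coeFn_maxParam x v a).symm.trans ?_
    rw [h]
    filter_upwards [Lp.coeFn_zero ℂ 2 (volume : Measure Plane)] with y hy
    rw [hy]
    simp

/-- A finite-dimensional span is closed, hence equal to its double orthogonal complement. -/
theorem exists_greenSum_eq {m : ℕ} (x : Fin m → Plane) {w : L2}
    (h : ∀ u : L2, (∀ j, inner ℂ (greenAt re_one_pos (x j)) u = 0) → inner ℂ w u = 0) :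
    ∃ a, greenSum re_one_pos x a = w := by
  set S := Submodule.span ℂ (Set.range fun j => greenAt re_one_pos (x j)) with hS
  have : FiniteDimensional ℂ S := FiniteDimensional.span_of_finite ℂ (Set.finite_range _)
  have hw : w ∈ Sᗮᗮ := by
    rw [Submodule.mem_orthogonal']
    intro u hu
    refine h u fun j => ?_
    exact (Submodule.mem_orthogonal _ _).1 hu _ (Submodule.subset_span (Set.mem_range_self j))
  rw [Submodule.orthogonal_orthogonal, hS, Submodule.mem_span_range_iff_exists_fun] at hw
  obtain ⟨c, hc⟩ := hw
  exact ⟨WithLp.toLp 2 c, hc⟩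

/-- The values of `(-Δ + 1)⁻¹ v` at the points `x_j`. -/
def pointValues {m : ℕ} (x : Fin m → Plane) : L2 →ₗ[ℂ] EuclideanSpace ℂ (Fin m) :=
  (WithLp.linearEquiv 2 ℂ (Fin m → ℂ)).symm.toLinearMap ∘ₗ
    LinearMap.pi fun j => (innerSL ℂ (greenAt re_one_pos (x j)) : L2 →ₗ[ℂ] ℂ)

theorem inner_greenSum_eq_inner_pointValues {m : ℕ} (x : Fin m → Plane)
    (a : EuclideanSpace ℂ (Fin m)) (v : L2) :
    inner ℂ (greenSum re_one_pos x a) v = inner ℂ a (pointValues x v) := by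
  rw [inner_greenSum, PiLp.inner_apply]
  rfl

/-- The orthogonal complement of the range is the kernel of the adjoint `greenSum`, which is trivial
by `maxParam_injective`. -/
theorem pointValues_surjective {m : ℕ} {x : Fin m → Plane} (hx : Function.Injective x) :
    Function.Surjective (pointValues x) := by
  rw [← LinearMap.range_eq_top, ← Submodule.orthogonal_eq_bot_iff, Submodule.eq_bot_iff]
  intro a ha
  have h1 : ∀ v, inner ℂ (greenSum re_one_pos x a) v = 0 := fun v => by
    rw [inner_greenSum_eq_inner_pointValues]
    exact (Submodule.mem_orthogonal' _ _).1 ha _ (LinearMap.mem_range_self _ v)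
  have h2 : greenSum re_one_pos x a = 0 := inner_self_eq_zero.1 (h1 _)
  have h3 : maxParam x (0, a) = 0 := by rw [maxParam_apply, map_zero, zero_add, h2]
  exact (Prod.mk.inj (maxParam_injective hx (h3.trans (map_zero _).symm))).2

/-! ### The minimal operator and its adjoint -/

theorem mem_minimalDomain_iff {m : ℕ} (x : Fin m → Plane) {f : L2} :
    f ∈ minimalDomain x ↔
      ∃ u, freeInv u = f ∧ ∀ j, inner ℂ (greenAt re_one_pos (x j)) u = 0 := by
  have h1 : (1 : ℂ) = starRingEnd ℂ 1 := by simp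
  constructor
  · rintro ⟨hf, v, hv, hfv, hv0⟩
    obtain ⟨u, rfl⟩ := (mem_W22_iff re_one_pos).1 hf
    exact ⟨u, rfl, fun j => by rw [← eq_inner_greenAt re_one_pos re_one_pos h1 hv hfv, hv0]⟩
  · rintro ⟨u, rfl, hu⟩
    exact ⟨freeResolvent_mem_W22 _ u, _, continuous_inner_greenAt re_one_pos u,
      coeFn_freeResolvent re_one_pos re_one_pos h1 u, hu⟩

theorem minimalOperator_apply_eq {m : ℕ} (x : Fin m → Plane) (f : (minimalOperator x).domain)
    {u : L2} (hu : freeInv u = f) : minimalOperator x f = u - f := by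
  apply toDist_injective
  rw [toDist_minimalOperator, ← hu, neg_laplacian_freeResolvent, one_pow, one_smul]

theorem minimalOperator_symmetric {m : ℕ} (x : Fin m → Plane) :
    (minimalOperator x).IsFormalAdjoint (minimalOperator x) := by
  intro f g
  obtain ⟨u, hu, -⟩ := (mem_minimalDomain_iff x).1 f.2
  obtain ⟨v, hv, -⟩ := (mem_minimalDomain_iff x).1 g.2
  rw [minimalOperator_apply_eq x f hu, minimalOperator_apply_eq x g hv, ← hu, ← hv,
    inner_sub_left, inner_sub_right, inner_freeResolvent_one u v]

/-- If `h` is orthogonal to the domain, then `freeInv h` is orthogonal to everything orthogonal to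
the Green functions, so it is a Green sum; injectivity of `maxParam` forces `h = 0`. -/
theorem minimalOperator_dense {m : ℕ} {x : Fin m → Plane} (hx : Function.Injective x) :
    Dense ((minimalOperator x).domain : Set L2) := by
  change Dense (minimalDomain x : Set L2)
  rw [Submodule.dense_iff_topologicalClosure_eq_top, Submodule.topologicalClosure_eq_top_iff,
    Submodule.eq_bot_iff]
  intro h hh
  obtain ⟨a, ha⟩ := exists_greenSum_eq x (w := freeInv h) fun u hu => by
    rw [inner_freeResolvent_one]
    exact (Submodule.mem_orthogonal' _ _).1 hh _ ((mem_minimalDomain_iff x).2 ⟨u, rfl, hu⟩)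
  have h3 : maxParam x (h, -a) = 0 := by rw [maxParam_apply, map_neg, ha, add_neg_cancel]
  exact (Prod.mk.inj (maxParam_injective hx (h3.trans (map_zero _).symm))).1

theorem minimalOperator_closed {m : ℕ} (x : Fin m → Plane) : (minimalOperator x).IsClosed := by
  have h : ((minimalOperator x).graph : Set (L2 × L2)) =
      {p | freeInv (p.1 + p.2) = p.1} ∩
        ⋂ j, {p | inner ℂ (greenAt re_one_pos (x j)) (p.1 + p.2) = 0} := by
    ext ⟨f, g⟩
    simp only [SetLike.mem_coe, LinearPMap.mem_graph_iff, Set.mem_inter_iff, Set.mem_iInter,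
      Set.mem_ofPred_eq]
    constructor
    · rintro ⟨f', rfl, rfl⟩
      obtain ⟨u, hu, hu0⟩ := (mem_minimalDomain_iff x).1 f'.2
      rw [minimalOperator_apply_eq x f' hu, add_sub_cancel]
      exact ⟨hu, hu0⟩
    · rintro ⟨h1, h2⟩
      refine ⟨⟨f, (mem_minimalDomain_iff x).2 ⟨_, h1, h2⟩⟩, rfl, ?_⟩
      rw [minimalOperator_apply_eq x _ h1, add_sub_cancel_left]
  rw [LinearPMap.IsClosed, h]
  refine IsClosed.inter (isClosed_eq (by fun_prop) (by fun_prop))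
    (isClosed_iInter fun j => isClosed_eq (by fun_prop) (by fun_prop))

theorem inner_maxParam_minimalOperator {m : ℕ} (x : Fin m → Plane) (v : L2)
    (a : EuclideanSpace ℂ (Fin m)) (f : (minimalOperator x).domain) :
    inner ℂ (v - maxParam x (v, a)) (f : L2) =
      inner ℂ (maxParam x (v, a)) (minimalOperator x f) := by
  obtain ⟨u, hu, hu0⟩ := (mem_minimalDomain_iff x).1 f.2
  have h : inner ℂ (greenSum re_one_pos x a) u = 0 := by
    rw [inner_greenSum]
    exact Finset.sum_eq_zero fun j _ => by rw [hu0 j, zero_mul]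
  rw [minimalOperator_apply_eq x f hu, ← hu, inner_sub_left, inner_sub_right, maxParam_apply,
    inner_add_left (freeInv v) _ u, h, add_zero, inner_freeResolvent_one v u]

/-- For `w = H* y`, testing against `freeInv u` with `u` orthogonal to the Green functions shows
that `y - freeInv (w + y)` is orthogonal to every such `u`, hence is a Green sum. -/
theorem mem_adjoint_domain_iff_maxParam {m : ℕ} {x : Fin m → Plane} (hx : Function.Injective x)
    {y : L2} : y ∈ (minimalOperator x)†.domain ↔ ∃ p, maxParam x p = y := by
  constructor
  · intro hy
    set w := (minimalOperator x)† ⟨y, hy⟩ with hw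
    obtain ⟨a, ha⟩ := exists_greenSum_eq x (w := y - freeInv (w + y)) fun u hu => by
      have h1 := LinearPMap.adjoint_isFormalAdjoint (minimalOperator_dense hx) ⟨y, hy⟩
        ⟨freeInv u, (mem_minimalDomain_iff x).2 ⟨u, rfl, hu⟩⟩
      rw [minimalOperator_apply_eq x _ rfl, inner_sub_right, ← hw] at h1
      rw [inner_sub_left, inner_freeResolvent_one, inner_add_left, h1]
      ring
    exact ⟨(w + y, a), by rw [maxParam_apply, ha, add_sub_cancel]⟩
  · rintro ⟨⟨v, a⟩, rfl⟩
    exact LinearPMap.mem_adjoint_domain_of_exists _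
      ⟨_, inner_maxParam_minimalOperator x v a⟩

theorem adjoint_apply_maxParam {m : ℕ} {x : Fin m → Plane} (hx : Function.Injective x)
    (f : (minimalOperator x)†.domain) {v : L2} {a : EuclideanSpace ℂ (Fin m)}
    (h : maxParam x (v, a) = f) : (minimalOperator x)† f = v - f :=
  LinearPMap.adjoint_apply_eq (minimalOperator_dense hx) f fun g => by
    rw [← h]
    exact inner_maxParam_minimalOperator x v a g

/-- The isomorphism `L² × ℂ^m ≃ dom H*`, `(v, a) ↦ (-Δ + 1)⁻¹ v + ∑ a_j G_1(· - x_j)`. -/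
def maxEquiv {m : ℕ} {x : Fin m → Plane} (hx : Function.Injective x) :
    (L2 × EuclideanSpace ℂ (Fin m)) ≃ₗ[ℂ] (minimalOperator x)†.domain :=
  LinearEquiv.ofBijective
    ((maxParam x).codRestrict _ fun p => (mem_adjoint_domain_iff_maxParam hx).2 ⟨p, rfl⟩)
    ⟨fun p q h => maxParam_injective hx (congrArg Subtype.val h), fun f => by
      obtain ⟨p, hp⟩ := (mem_adjoint_domain_iff_maxParam hx).1 f.2
      exact ⟨p, Subtype.ext hp⟩⟩

theorem coe_maxEquiv {m : ℕ} {x : Fin m → Plane} (hx : Function.Injective x)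
    (p : L2 × EuclideanSpace ℂ (Fin m)) : (maxEquiv hx p : L2) = maxParam x p := rfl

theorem inner_toEuclideanLin_greenMatrix_one {m : ℕ} (x : Fin m → Plane)
    (a b : EuclideanSpace ℂ (Fin m)) :
    inner ℂ (Matrix.toEuclideanLin (greenMatrix 1 x) a) b =
      inner ℂ a (Matrix.toEuclideanLin (greenMatrix 1 x) b) := by
  have h : (greenMatrix 1 x).conjTranspose = greenMatrix 1 x := by
    ext j l
    rw [Matrix.conjTranspose_apply]
    exact conj_greenMatrix_one x l j
  conv_lhs => rw [← h, Matrix.toEuclideanLin_conjTranspose_eq_adjoint]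
  exact LinearMap.adjoint_inner_left _ _ _

/-! ### Construction of the boundary triplet -/

/-- The boundary triplet of `H*`. -/
def pointTriplet {m : ℕ} {x : Fin m → Plane} (hx : Function.Injective x) :
    BoundaryTriplet (minimalOperator x) (EuclideanSpace ℂ (Fin m)) where
  dense_domain := minimalOperator_dense hx
  symmetric := minimalOperator_symmetric x
  closed := minimalOperator_closed x
  Γ₀ := LinearMap.snd ℂ _ _ ∘ₗ (maxEquiv hx).symm.toLinearMap
  Γ₁ := (LinearMap.coprod (pointValues x) (Matrix.toEuclideanLin (greenMatrix 1 x))) ∘ₗ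
    (maxEquiv hx).symm.toLinearMap
  green f g := by
    obtain ⟨⟨v, a⟩, rfl⟩ := (maxEquiv hx).surjective f
    obtain ⟨⟨w, b⟩, rfl⟩ := (maxEquiv hx).surjective g
    rw [adjoint_apply_maxParam hx _ (coe_maxEquiv hx (v, a)).symm,
      adjoint_apply_maxParam hx _ (coe_maxEquiv hx (w, b)).symm]
    simp only [LinearMap.coe_comp, LinearEquiv.coe_coe, Function.comp_apply,
      LinearEquiv.symm_apply_apply, LinearMap.snd_apply, LinearMap.coprod_apply, inner_add_left,
      inner_add_right, inner_toEuclideanLin_greenMatrix_one, inner_sub_left, inner_sub_right,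
      coe_maxEquiv]
    -- The matrix terms match by Hermitian symmetry and the `freeInv` terms cancel; the cross terms
    -- are pairings of `a`, `b` with point values.
    rw [maxParam_apply, maxParam_apply, inner_add_left _ _ v, inner_add_right w,
      inner_greenSum_eq_inner_pointValues, inner_freeResolvent_one,
      ← inner_conj_symm w (greenSum re_one_pos x a), inner_greenSum_eq_inner_pointValues,
      inner_conj_symm]
    ring
  surjective h₀ h₁ := by
    obtain ⟨v, hv⟩ := pointValues_surjective hx
      (h₁ - Matrix.toEuclideanLin (greenMatrix 1 x) h₀)
    refine ⟨maxEquiv hx (v, h₀), ?_, ?_⟩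
    · simp
    · simp [hv]

theorem isPointTriplet_pointTriplet {m : ℕ} {x : Fin m → Plane} (hx : Function.Injective x) :
    IsPointTriplet x (pointTriplet hx) := by
  intro f
  obtain ⟨⟨v, a⟩, rfl⟩ := (maxEquiv hx).surjective f
  obtain ⟨h1, h2⟩ := hasLogExpansion_add_sum_green re_one_pos hx
    (continuous_inner_greenAt re_one_pos v) a
  refine ⟨_, _, coeFn_maxParam x v a, h1, fun j => ⟨(h2 j).1, ?_, ?_⟩⟩
  · have h3 : (pointTriplet hx).Γ₀ (maxEquiv hx (v, a)) = a := by simp [pointTriplet]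
    have : (Real.pi : ℂ) ≠ 0 := by exact_mod_cast Real.pi_ne_zero
    rw [h3]
    field_simp
  · have h3 : (pointTriplet hx).Γ₁ (maxEquiv hx (v, a)) =
        pointValues x v + Matrix.toEuclideanLin (greenMatrix 1 x) a := by simp [pointTriplet]
    rw [h3]
    exact (h2 j).2

/-! ### Weyl function and gamma-field of an arbitrary such triplet -/

theorem cpow_half_sq (w : ℂ) : (w ^ (1 / 2 : ℂ)) ^ 2 = w := by
  rw [one_div]
  exact_mod_cast Complex.cpow_nat_inv_pow w two_ne_zero

theorem re_neg_cpow_half_pos {z : ℂ} (hz : ¬(0 ≤ z.re ∧ z.im = 0)) :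
    0 < ((-z) ^ (1 / 2 : ℂ)).re := by
  have h0 : -z ≠ 0 := by
    rintro h
    rw [neg_eq_zero] at h
    simp [h] at hz
  have harg : (-z).arg ≠ Real.pi := fun h => by
    rw [Complex.arg_eq_pi_iff] at h
    refine hz ⟨?_, by simpa using h.2⟩
    have := h.1
    rw [Complex.neg_re] at this
    linarith
  have h1 := Complex.neg_pi_lt_arg (-z)
  have h2 := lt_of_le_of_ne (Complex.arg_le_pi (-z)) harg
  rw [Complex.cpow_def_of_ne_zero h0, Complex.exp_re]
  refine mul_pos (Real.exp_pos _) (Real.cos_pos_of_mem_Ioo ?_)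
  have h3 : (Complex.log (-z) * (1 / 2)).im = (-z).arg / 2 := by
    rw [← Complex.log_im, show (1 / 2 : ℂ) = ((1 / 2 : ℝ) : ℂ) by simp, Complex.im_mul_ofReal]
    ring
  rw [h3]
  constructor <;> linarith

section PointTriplet

variable {m : ℕ} {x : Fin m → Plane}
  {T : BoundaryTriplet (minimalOperator x) (EuclideanSpace ℂ (Fin m))}

theorem IsPointTriplet.boundaryValues_eq (hT : IsPointTriplet x T)
    {f : (minimalOperator x)†.domain} {u : Plane → ℂ} {ξ b : Fin m → ℂ}
    (hfu : (f : L2) =ᵐ[volume] u) (h : HasLogExpansion x u ξ b) :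
    (∀ j, T.Γ₀ f j = -2 * Real.pi * ξ j) ∧ ∀ j, T.Γ₁ f j = b j := by
  obtain ⟨u', ξ', hfu', hc, h'⟩ := hT f
  obtain ⟨h1, h2⟩ := h.unique (u' := u') (ξ' := ξ') (b' := fun j => T.Γ₁ f j)
    ⟨hc, fun j => ⟨(h' j).1, (h' j).2.2⟩⟩ (hfu.symm.trans hfu')
  refine ⟨fun j => ?_, fun j => (congrFun h2 j).symm⟩
  rw [h1]
  exact (h' j).2.1

theorem IsPointTriplet.boundaryValues_add_greenSum (hT : IsPointTriplet x T)
    (hx : Function.Injective x) {k : ℂ} (hk : 0 < k.re) {f : (minimalOperator x)†.domain}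
    {c : Plane → ℂ} (hc : Continuous c) {a : EuclideanSpace ℂ (Fin m)}
    (hf : (f : L2) =ᵐ[volume] fun y => c y + ∑ l, a l * green k (y - x l)) :
    T.Γ₀ f = a ∧ ∀ j, T.Γ₁ f j = c (x j) + (greenMatrix k x).mulVec a j := by
  obtain ⟨h0, h1⟩ := hT.boundaryValues_eq hf (hasLogExpansion_add_sum_green hk hx hc a)
  refine ⟨?_, h1⟩
  ext j
  have : (Real.pi : ℂ) ≠ 0 := by exact_mod_cast Real.pi_ne_zero
  rw [h0]
  field_simp

/-- On `freeInv v + greenSum a` the value of `Γ₀` is `a`, so its kernel is the range of the free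
resolvent. Thus `T.A₀` is the free Laplacian. -/
theorem IsPointTriplet.mem_A₀_domain_iff (hT : IsPointTriplet x T)
    (hx : Function.Injective x) {f : L2} : f ∈ T.A₀.domain ↔ f ∈ W22 := by
  rw [T.mem_A₀_domain, mem_W22_iff re_one_pos]
  constructor
  · rintro ⟨h, h0⟩
    obtain ⟨⟨v, a⟩, hp⟩ := (mem_adjoint_domain_iff_maxParam hx).1 h
    have h1 := (hT.boundaryValues_add_greenSum hx re_one_pos (f := ⟨f, h⟩)
      (continuous_inner_greenAt re_one_pos v) (hp ▸ coeFn_maxParam x v a)).1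
    rw [h0] at h1
    refine ⟨v, ?_⟩
    rw [← hp, maxParam_apply, ← h1, map_zero, add_zero]
  · rintro ⟨v, rfl⟩
    have hp : maxParam x (v, 0) = freeInv v := by rw [maxParam_apply, map_zero, add_zero]
    have h := (mem_adjoint_domain_iff_maxParam hx).2 ⟨_, hp⟩
    have he := coeFn_maxParam x v 0
    rw [hp] at he
    exact ⟨h, (hT.boundaryValues_add_greenSum hx re_one_pos (f := ⟨_, h⟩)
      (continuous_inner_greenAt re_one_pos v) he).1⟩

theorem IsPointTriplet.toDist_A₀ (hT : IsPointTriplet x T) (hx : Function.Injective x)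
    (f : T.A₀.domain) : toDist (T.A₀ f) = -Δ (toDist f) := by
  obtain ⟨v, hv⟩ := (mem_W22_iff re_one_pos).1 ((hT.mem_A₀_domain_iff hx).1 f.2)
  obtain ⟨h, -⟩ := T.mem_A₀_domain.1 f.2
  rw [T.A₀_apply f h, adjoint_apply_maxParam hx ⟨f, h⟩ (v := v) (a := 0)
    (by rw [maxParam_apply, map_zero, add_zero, hv]), ← hv, neg_laplacian_freeResolvent,
    one_pow, one_smul]

theorem IsPointTriplet.mem_resolventSet (hT : IsPointTriplet x T) (hx : Function.Injective x)
    {k : ℂ} (hk : 0 < k.re) : -k ^ 2 ∈ resolventSet T.A₀ := by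
  refine ⟨freeResolvent hk, fun f => ?_, fun g => ?_⟩
  · rw [neg_smul, sub_neg_eq_add]
    exact freeResolvent_of_neg_laplacian hk (hT.toDist_A₀ hx f)
  · have h := (hT.mem_A₀_domain_iff hx).2 (freeResolvent_mem_W22 hk g)
    refine ⟨h, toDist_injective ?_⟩
    rw [map_sub, hT.toDist_A₀ hx, neg_laplacian_freeResolvent, ← map_sub, neg_smul]
    abel_nf

/-- The inner product is the value at `x_j` of `(-Δ + l²)⁻¹ (H + l²) f = f`, which vanishes on `dom
H`. This puts the Green sums into the defect subspace. -/
theorem inner_greenAt_minimalOperator_add {k l : ℂ} (hk : 0 < k.re) (h : l = starRingEnd ℂ k)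
    (f : (minimalOperator x).domain) (j : Fin m) :
    inner ℂ (greenAt hk (x j)) (minimalOperator x f + l ^ 2 • (f : L2)) = 0 := by
  have hl : 0 < l.re := by rwa [h, Complex.conj_re]
  obtain ⟨v, hv, hfv, hv0⟩ := f.2.2
  rw [← eq_inner_greenAt hk hl h hv (by
    rwa [freeResolvent_of_neg_laplacian hl (toDist_minimalOperator x f)]) (x j), hv0]

theorem inner_neg_sq_smul_greenSum {k : ℂ} (hk : 0 < k.re) (a : EuclideanSpace ℂ (Fin m))
    (f : (minimalOperator x).domain) :
    inner ℂ (-k ^ 2 • greenSum hk x a) (f : L2) =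
      inner ℂ (greenSum hk x a) (minimalOperator x f) := by
  have h : inner ℂ (greenSum hk x a) (minimalOperator x f + (starRingEnd ℂ k) ^ 2 • (f : L2)) =
      0 := by
    rw [inner_greenSum]
    exact Finset.sum_eq_zero fun j _ => by
      rw [inner_greenAt_minimalOperator_add hk rfl, zero_mul]
  rw [inner_add_right, inner_smul_right] at h
  rw [inner_smul_left, map_neg, map_pow]
  linear_combination -h

theorem greenSum_mem_adjoint_domain {k : ℂ} (hk : 0 < k.re) (a : EuclideanSpace ℂ (Fin m)) :
    greenSum hk x a ∈ (minimalOperator x)†.domain :=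
  LinearPMap.mem_adjoint_domain_of_exists _ ⟨_, inner_neg_sq_smul_greenSum hk a⟩

theorem greenSum_mem_defectSubspace (hx : Function.Injective x) {k : ℂ} (hk : 0 < k.re)
    (a : EuclideanSpace ℂ (Fin m)) :
    ⟨greenSum hk x a, greenSum_mem_adjoint_domain hk a⟩ ∈
      defectSubspace (minimalOperator x) (-k ^ 2) :=
  mem_defectSubspace.2 <| LinearPMap.adjoint_apply_eq (minimalOperator_dense hx) _
    (inner_neg_sq_smul_greenSum hk a)

theorem IsPointTriplet.boundaryValues_greenSum (hT : IsPointTriplet x T)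
    (hx : Function.Injective x) {k : ℂ} (hk : 0 < k.re) (a : EuclideanSpace ℂ (Fin m)) :
    T.Γ₀ ⟨greenSum hk x a, greenSum_mem_adjoint_domain hk a⟩ = a ∧
      ∀ j, T.Γ₁ ⟨greenSum hk x a, greenSum_mem_adjoint_domain hk a⟩ j =
        (greenMatrix k x).mulVec a j := by
  have h := hT.boundaryValues_add_greenSum hx hk
    (f := ⟨greenSum hk x a, greenSum_mem_adjoint_domain hk a⟩) (c := fun _ => 0)
    continuous_const (by simpa using coeFn_greenSum hk x a)
  simpa using h

theorem IsPointTriplet.gammaField_eq (hT : IsPointTriplet x T) (hx : Function.Injective x)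
    {k : ℂ} (hk : 0 < k.re) (hz : -k ^ 2 ∈ resolventSet T.A₀) (a : EuclideanSpace ℂ (Fin m)) :
    T.gammaField (-k ^ 2) hz a =
      ⟨⟨greenSum hk x a, greenSum_mem_adjoint_domain hk a⟩,
        greenSum_mem_defectSubspace hx hk a⟩ := by
  refine (LinearEquiv.symm_apply_eq _).2 ?_
  exact (hT.boundaryValues_greenSum hx hk a).1.symm

theorem IsPointTriplet.weylFunction_eq (hT : IsPointTriplet x T) (hx : Function.Injective x)
    {k : ℂ} (hk : 0 < k.re) (hz : -k ^ 2 ∈ resolventSet T.A₀) :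
    T.weylFunction (-k ^ 2) hz = (Matrix.toEuclideanCLM (𝕜 := ℂ) (greenMatrix k x) :
      EuclideanSpace ℂ (Fin m) →ₗ[ℂ] EuclideanSpace ℂ (Fin m)) := by
  refine LinearMap.ext fun a => ?_
  ext j
  change T.Γ₁ (T.gammaField (-k ^ 2) hz a) j = _
  rw [hT.gammaField_eq hx hk, (hT.boundaryValues_greenSum hx hk a).2]
  rfl

end PointTriplet

theorem weylMatrix_eq_greenMatrix {m : ℕ} (x : Fin m → Plane) (z : ℂ) :
    weylMatrix x z = greenMatrix ((-z) ^ (1 / 2 : ℂ)) x := by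
  ext j l
  simp only [weylMatrix, greenMatrix, Matrix.of_apply]
  split_ifs with h
  · rw [sqrtUp, mul_comm 2 Complex.I, mul_div_mul_left _ _ Complex.I_ne_zero]
  · exact hankel_sqrtUp_mul z _

theorem IsPointTriplet.weyl_and_gamma {m : ℕ} {x : Fin m → Plane}
    {T : BoundaryTriplet (minimalOperator x) (EuclideanSpace ℂ (Fin m))}
    (hT : IsPointTriplet x T) (hx : Function.Injective x) {z : ℂ}
    (hz0 : ¬(0 ≤ z.re ∧ z.im = 0)) :
    ∃ hz : z ∈ resolventSet T.A₀,
      T.weylFunction z hz = (Matrix.toEuclideanCLM (𝕜 := ℂ) (weylMatrix x z) :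
        EuclideanSpace ℂ (Fin m) →ₗ[ℂ] EuclideanSpace ℂ (Fin m)) ∧
      ∀ a : EuclideanSpace ℂ (Fin m),
        ((T.gammaField z hz a : (minimalOperator x)†.domain) : L2) =ᵐ[volume]
          fun y => ∑ j, a j * (Complex.I / 4 * hankel (sqrtUp z * ‖y - x j‖)) := by
  have hk := re_neg_cpow_half_pos hz0
  rw [weylMatrix_eq_greenMatrix]
  simp only [hankel_sqrtUp_mul]
  have hkz := cpow_half_sq (-z)
  generalize (-z) ^ (1 / 2 : ℂ) = k at hk hkz
  -- Only `Re k > 0` and `k² = -z` matter from here, so the branch of the root is forgotten.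
  obtain rfl : z = -k ^ 2 := by rw [hkz, neg_neg]
  refine ⟨hT.mem_resolventSet hx hk, hT.weylFunction_eq hx hk _, fun a => ?_⟩
  rw [hT.gammaField_eq hx hk]
  exact coeFn_greenSum hk x a

end PointInteraction

end

theorem proposition5p3 (m : ℕ) (x : Fin m → PointInteraction.Plane) (hx : Function.Injective x) :
    (∃ T : BoundaryTriplets.BoundaryTriplet (PointInteraction.minimalOperator x)
        (EuclideanSpace ℂ (Fin m)), PointInteraction.IsPointTriplet x T) ∧
    ∀ T : BoundaryTriplets.BoundaryTriplet (PointInteraction.minimalOperator x)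
        (EuclideanSpace ℂ (Fin m)), PointInteraction.IsPointTriplet x T →
      ∀ z : ℂ, ¬ (0 ≤ z.re ∧ z.im = 0) →
        ∃ hz : z ∈ BoundaryTriplets.resolventSet T.A₀,
          T.weylFunction z hz =
            (Matrix.toEuclideanCLM (𝕜 := ℂ) (PointInteraction.weylMatrix x z) :
              EuclideanSpace ℂ (Fin m) →ₗ[ℂ] EuclideanSpace ℂ (Fin m)) ∧
          ∀ a : EuclideanSpace ℂ (Fin m),
            ((T.gammaField z hz a : (PointInteraction.minimalOperator x).adjoint.domain) :
                PointInteraction.L2) =ᵐ[volume]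
              fun y => ∑ j, a j *
                (Complex.I / 4 *
                  PointInteraction.hankel (PointInteraction.sqrtUp z * ‖y - x j‖)) := by
  exact ⟨⟨PointInteraction.pointTriplet hx, PointInteraction.isPointTriplet_pointTriplet hx⟩,
    fun _ hT _ hz => hT.weyl_and_gamma hx hz⟩
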